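/- There is an absolute constant $\varepsilon>0$ with the following property. Let $u$ be complex-valued and let $n,v$ be real-valued, with $$(u,n,v)\in C\big([0,\infty),\,H^1(\mathbb R)\times L^2(\mathbb R)\times L^2(\mathbb R)\big),$$ and suppose that $(u,n,v)$ is a solution, in the sense of distributions for $t>0$, of the one-dimensional Zakharov system in first-order form $$i u_t+u_{xx}=nu,\qquad n_t+v_x=0,\qquad v_t+\big(n+|u|^2\big)_x=0 .$$ (For every such $(u,n,v)$ and every $t \ge 0$, the energy $\int_{\mathbb R}|u_x|^2+\tfrac12(|n|^2+|v|^2)+n|u|^2\,dx$ is finite.) Assume that $u(t,\cdot)$ is odd for every $t\ge 0$ and that $$\sup_{t\ge 0}\|u(t)\|_{H^1(\mathbb R)}<\varepsilon .$$ Then for every compact interval $I\subset\mathbb R$, $$\lim_{t\to\infty}\Big(\|u(t)\|_{L^\infty(I)}+\|u(t)\|_{L^2(I)}+\|n(t)\|_{L^2(I)}+\|v(t)\|_{L^2(I)}\Big)=0 .$$ -/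

import Mathlib

open MeasureTheory Filter Topology
open scoped ENNReal ContDiff

namespace Zakharov

/-- The Lebesgue space `L²(ℝ; E)` with its usual norm. -/
abbrev L2 (E : Type) [NormedAddCommGroup E] : Type := Lp E 2 (volume : Measure ℝ)

/-- Real test functions on the line: smooth with compact support. -/
def IsTest (η : ℝ → ℝ) : Prop := ContDiff ℝ ∞ η ∧ HasCompactSupport η

/-- `g` is the weak (distributional) derivative of `f` on `ℝ`. -/
def IsWeakDeriv (f g : L2 ℂ) : Prop :=
  ∀ η : ℝ → ℝ, IsTest η → ∫ x, ((deriv η x : ℝ) : ℂ) * f x = -∫ x, ((η x : ℝ) : ℂ) * g x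

theorem IsTest.deriv {η : ℝ → ℝ} (h : IsTest η) : IsTest (deriv η) :=
  ⟨((contDiff_infty_iff_deriv (𝕜 := ℝ)).1 h.1).2, h.2.deriv⟩

theorem IsTest.integrable_mul {η : ℝ → ℝ} (h : IsTest η) (f : L2 ℂ) :
    Integrable (fun x => ((η x : ℝ) : ℂ) * f x) := by
  have hc : Continuous fun x => ((η x : ℝ) : ℂ) := Complex.continuous_ofReal.comp h.1.continuous
  have hs : HasCompactSupport fun x => ((η x : ℝ) : ℂ) :=
    h.2.comp_left (g := fun r : ℝ => (r : ℂ)) Complex.ofReal_zero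
  exact MemLp.integrable_mul (p := 2) (q := 2) (hc.memLp_of_hasCompactSupport hs) (Lp.memLp f)

theorem IsWeakDeriv.add {f g f' g' : L2 ℂ} (h : IsWeakDeriv f g) (h' : IsWeakDeriv f' g') :
    IsWeakDeriv (f + f') (g + g') := by
  have key : ∀ (η : ℝ → ℝ), IsTest η → ∀ a b : L2 ℂ,
      ∫ x, ((η x : ℝ) : ℂ) * (a + b : L2 ℂ) x
        = (∫ x, ((η x : ℝ) : ℂ) * a x) + ∫ x, ((η x : ℝ) : ℂ) * b x := by
    intro η hη a b
    rw [← integral_add (hη.integrable_mul a) (hη.integrable_mul b)]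
    refine integral_congr_ae ?_
    filter_upwards [Lp.coeFn_add a b] with x hx
    rw [hx, Pi.add_apply, mul_add]
  intro η hη
  rw [key _ hη.deriv, key _ hη, h η hη, h' η hη, neg_add]

theorem IsWeakDeriv.smul (c : ℂ) {f g : L2 ℂ} (h : IsWeakDeriv f g) :
    IsWeakDeriv (c • f) (c • g) := by
  have key : ∀ (η : ℝ → ℝ) (a : L2 ℂ),
      ∫ x, ((η x : ℝ) : ℂ) * (c • a : L2 ℂ) x = c * ∫ x, ((η x : ℝ) : ℂ) * a x := by
    intro η a
    rw [← integral_const_mul]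
    refine integral_congr_ae ?_
    filter_upwards [Lp.coeFn_smul c a] with x hx
    rw [hx, Pi.smul_apply, smul_eq_mul]
    ring
  intro η hη
  rw [key, key, h η hη, mul_neg]

theorem IsWeakDeriv.zero : IsWeakDeriv 0 0 := by
  have key : ∀ ζ : ℝ → ℝ, ∫ x, ((ζ x : ℝ) : ℂ) * (0 : L2 ℂ) x = 0 := by
    intro ζ
    refine integral_eq_zero_of_ae ?_
    filter_upwards [Lp.coeFn_zero ℂ 2 (volume : Measure ℝ)] with x hx
    rw [hx, Pi.zero_apply, mul_zero]
  intro η _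
  rw [key, key, neg_zero]

/-- The Sobolev space `H¹(ℝ; ℂ)`, realised as the space of pairs `(f, f')` in `L² × L²` such that
`f'` is the weak derivative of `f`. The inherited norm is
`‖f‖_{H¹} = (‖f‖_{L²}² + ‖f'‖_{L²}²)^{1/2}`. -/
def H1 : Submodule ℂ (WithLp 2 (L2 ℂ × L2 ℂ)) where
  carrier := {p | IsWeakDeriv p.fst p.snd}
  add_mem' ha hb := IsWeakDeriv.add ha hb
  zero_mem' := IsWeakDeriv.zero
  smul_mem' c _ h := IsWeakDeriv.smul c h

/-- The underlying function of an element of `H¹`. -/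
def H1.toL2 (f : H1) : L2 ℂ := f.1.fst

/-- `(u, n, v)` solves, for `t > 0`, in the sense of distributions,
`i u_t + u_xx = n u`, `n_t + v_x = 0`, `v_t + (n + |u|²)_x = 0`.
Each equation is tested against functions of `x`; for continuous `(u, n, v)` this is the same as
testing against functions of `(t, x)` supported in `t > 0`, since all the pairings below are
continuous functions of `t`. The first equation is written as `u_t = i (u_xx - n u)`. -/
structure IsSolution (u : ℝ → H1) (n v : ℝ → L2 ℝ) : Prop where
  schrodinger : ∀ η : ℝ → ℝ, IsTest η → ∀ t : ℝ, 0 < t →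
    HasDerivAt (fun s => ∫ x, ((η x : ℝ) : ℂ) * H1.toL2 (u s) x)
      (Complex.I * ((∫ x, ((deriv (deriv η) x : ℝ) : ℂ) * H1.toL2 (u t) x)
        - ∫ x, ((η x : ℝ) : ℂ) * (((n t x : ℝ) : ℂ) * H1.toL2 (u t) x))) t
  density : ∀ η : ℝ → ℝ, IsTest η → ∀ t : ℝ, 0 < t →
    HasDerivAt (fun s => ∫ x, η x * n s x) (∫ x, deriv η x * v t x) t
  velocity : ∀ η : ℝ → ℝ, IsTest η → ∀ t : ℝ, 0 < t →
    HasDerivAt (fun s => ∫ x, η x * v s x)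
      (∫ x, deriv η x * (n t x + ‖H1.toL2 (u t) x‖ ^ 2)) t

/-- An element of `L²` is odd, as an almost-everywhere class. -/
def IsOdd (f : L2 ℂ) : Prop := ∀ᵐ x : ℝ, f (-x) = -f x

end Zakharov

/-
The decay comes from the virial functional `∫ ψ (Im (ū u_x) + n v)`, where `ψ` is the bounded
primitive of `exp (-2 |x|)`. Its time derivative is a quadratic form in the weighted fields plus the
cubic term `∫ ψ' n |u|²`. An odd `u` vanishes at the origin, and then a Hardy-type inequality bounds
`∫ (w u)²` and `∫ (w² u_x)²` by `∫ ((w u)_x)²` for `w = exp (-|x|)`, so that the quadratic form is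
coercive and, for `‖u‖ ≤ 1/2`, absorbs the cubic term. Conservation of energy bounds `n` and `v` in
`L²`, hence the virial functional is bounded and its coercive part is integrable in time. That part
dominates both the mass localized by `exp (-4 |x|)` and the time derivative of this mass, which
therefore tends to zero. The identities are justified at energy regularity by applying the
resolvents `(1 - δ² ∂ₓ²)⁻¹` to the equations and letting `δ → 0`.
-/

namespace Zakharov

open scoped InnerProductSpace NNReal

/-! ### Primitives of locally integrable functions -/

theorem absolutelyContinuousOnInterval_of_dist_le {X Y : Type*} [PseudoMetricSpace X]
    [PseudoMetricSpace Y] {f : ℝ → X} {g : ℝ → Y} {a b : ℝ}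
    (hg : AbsolutelyContinuousOnInterval g a b)
    (hfg : ∀ x y, dist (f x) (f y) ≤ dist (g x) (g y)) : AbsolutelyContinuousOnInterval f a b :=
  squeeze_zero (fun _ => Finset.sum_nonneg fun _ _ => dist_nonneg)
    (fun _ => Finset.sum_le_sum fun _ _ => hfg _ _) hg

theorem measurable_sign : Measurable fun x : ℝ => (SignType.sign x : ℝ) := by
  have hmono : Monotone fun s : SignType => (s : ℝ) := by
    rintro (_ | _ | _) (_ | _ | _) h <;> first | exact absurd h (by decide) | simp
  exact (hmono.comp SignType.sign.monotone).measurable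

theorem abs_sign_le_one (x : ℝ) : |(SignType.sign x : ℝ)| ≤ 1 := by
  rcases lt_trichotomy x 0 with hx | rfl | hx <;> simp [*]

theorem sign_mul_sign {x : ℝ} (hx : x ≠ 0) : (SignType.sign x : ℝ) * SignType.sign x = 1 := by
  rcases hx.lt_or_gt with hx | hx <;> simp [hx]

theorem sign_eq_of_mem_uIoc {x t : ℝ} (ht : t ∈ Set.uIoc 0 x) (ht0 : t ≠ 0) :
    SignType.sign t = SignType.sign x := by
  rcases Set.mem_uIoc.1 ht with ⟨h0, h⟩ | ⟨h, h0⟩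
  · rw [sign_pos h0, sign_pos (h0.trans_le h)]
  · rw [sign_neg (h0.lt_of_ne ht0), sign_neg (h.trans_le h0)]

/-- `F` is a primitive of the locally integrable function `f`. This is the one-dimensional form of
"`f` is the weak derivative of `F`", with `F` the absolutely continuous representative. -/
structure IsPrimitive {E : Type*} [NormedAddCommGroup E] [NormedSpace ℝ E] (F f : ℝ → E) :
    Prop where
  locallyIntegrable : LocallyIntegrable f
  eq_add : ∀ x, F x = F 0 + ∫ t in (0 : ℝ)..x, f t

namespace IsPrimitive

section NormedSpace

variable {E : Type*} [NormedAddCommGroup E] [NormedSpace ℝ E] {F f g : ℝ → E}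

theorem integral (hf : LocallyIntegrable f) : IsPrimitive (fun x => ∫ t in (0 : ℝ)..x, f t) f :=
  ⟨hf, by simp⟩

theorem intervalIntegrable (h : IsPrimitive F f) (a b : ℝ) : IntervalIntegrable f volume a b :=
  intervalIntegrable_iff.mpr <|
    (h.locallyIntegrable.integrableOn_isCompact isCompact_uIcc).mono_set Set.uIoc_subset_uIcc

theorem sub_eq_integral (h : IsPrimitive F f) (a b : ℝ) : F b - F a = ∫ t in a..b, f t := by
  rw [h.eq_add a, h.eq_add b,
    ← intervalIntegral.integral_interval_sub_left (h.intervalIntegrable 0 b)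
      (h.intervalIntegrable 0 a)]
  abel

theorem congr (h : IsPrimitive F f) (hfg : f =ᵐ[volume] g) : IsPrimitive F g where
  locallyIntegrable x :=
    let ⟨s, hs, hi⟩ := h.locallyIntegrable x
    ⟨s, hs, hi.congr (ae_restrict_of_ae hfg)⟩
  eq_add x := by
    rw [h.eq_add x, intervalIntegral.integral_congr_ae (hfg.mono fun t ht _ => ht)]

theorem comp_continuousLinearMap {E' : Type*} [NormedAddCommGroup E'] [NormedSpace ℝ E']
    [CompleteSpace E] [CompleteSpace E'] (h : IsPrimitive F f) (L : E →L[ℝ] E') :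
    IsPrimitive (fun x => L (F x)) (fun x => L (f x)) where
  locallyIntegrable x :=
    let ⟨s, hs, hi⟩ := h.locallyIntegrable x
    ⟨s, hs, L.integrable_comp hi⟩
  eq_add x := by
    rw [L.intervalIntegral_comp_comm (h.intervalIntegrable 0 x), h.eq_add x, map_add]

theorem of_hasDerivAt [CompleteSpace E] (hF : ∀ x, HasDerivAt F (f x) x) (hf : Continuous f) :
    IsPrimitive F f where
  locallyIntegrable := hf.locallyIntegrable
  eq_add x := by
    rw [intervalIntegral.integral_eq_sub_of_hasDerivAt (fun y _ => hF y)
      (hf.intervalIntegrable _ _), add_sub_cancel]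

theorem continuous (h : IsPrimitive F f) : Continuous F := by
  rw [funext h.eq_add]
  exact continuous_const.add (intervalIntegral.continuous_primitive h.intervalIntegrable 0)

theorem ae_hasDerivAt [CompleteSpace E] (h : IsPrimitive F f) : ∀ᵐ x, HasDerivAt F (f x) x := by
  filter_upwards [_root_.LocallyIntegrable.ae_hasDerivAt_integral h.locallyIntegrable] with x hx
  rw [funext h.eq_add]
  exact (hx 0).const_add _

theorem absolutelyContinuousOnInterval (h : IsPrimitive F f) (a b : ℝ) :
    AbsolutelyContinuousOnInterval F a b := by
  have hint : ∀ x y, IntervalIntegrable (fun t => ‖f t‖) volume x y := fun x y =>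
    (h.intervalIntegrable x y).norm
  refine absolutelyContinuousOnInterval_of_dist_le
    ((hint a b).absolutelyContinuousOnInterval_intervalIntegral Set.left_mem_uIcc) fun x y => ?_
  rw [dist_eq_norm', dist_eq_norm', h.sub_eq_integral, Real.norm_eq_abs,
    intervalIntegral.integral_interval_sub_left (hint a y) (hint a x)]
  exact intervalIntegral.norm_integral_le_abs_integral_norm

theorem of_absolutelyContinuousOnInterval [CompleteSpace E]
    (hF : ∀ a b, AbsolutelyContinuousOnInterval F a b) (hf : LocallyIntegrable f)
    (hderiv : ∀ᵐ x, HasDerivAt F (f x) x) : IsPrimitive F f where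
  locallyIntegrable := hf
  eq_add x := by
    have hI := integral hf
    obtain ⟨C, hC⟩ := ((hF 0 x).sub
      (hI.absolutelyContinuousOnInterval 0 x)).const_of_ae_hasDerivAt_zero (by
        filter_upwards [hderiv, hI.ae_hasDerivAt] with y hFy hIy _
        simpa using hFy.sub hIy)
    have h0 := hC 0 Set.left_mem_uIcc
    have hx := hC x Set.right_mem_uIcc
    simp only [Pi.sub_apply, intervalIntegral.integral_same, sub_zero] at h0 hx
    rw [h0, ← hx, sub_add_cancel]

theorem integral_Iic_eq (h : IsPrimitive F f) (hF : Integrable F) (hf : Integrable f) (x : ℝ) :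
    ∫ t in Set.Iic x, f t = F x := by
  have hlim : Tendsto F atBot (𝓝 (F x - ∫ t in Set.Iic x, f t)) := by
    refine (tendsto_const_nhds.sub (intervalIntegral_tendsto_integral_Iic x hf.integrableOn
      tendsto_id)).congr fun y => ?_
    rw [id, ← h.sub_eq_integral, sub_sub_cancel]
  refine (sub_eq_zero.1 (IntegrableAtFilter.eq_zero_of_tendsto (μ := volume)
    ⟨Set.univ, univ_mem, hF.integrableOn⟩ (fun s hs => ?_) hlim)).symm
  obtain ⟨b, hb⟩ := mem_atBot_sets.1 hs
  rw [← top_le_iff, ← Real.volume_Iic (a := b)]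
  exact measure_mono hb

theorem integral_Ioi_eq (h : IsPrimitive F f) (hF : Integrable F) (hf : Integrable f) (x : ℝ) :
    ∫ t in Set.Ioi x, f t = -F x := by
  have hlim : Tendsto F atTop (𝓝 (F x + ∫ t in Set.Ioi x, f t)) := by
    refine (tendsto_const_nhds.add (intervalIntegral_tendsto_integral_Ioi x hf.integrableOn
      tendsto_id)).congr fun y => ?_
    rw [id, ← h.sub_eq_integral, add_sub_cancel]
  refine eq_neg_of_add_eq_zero_right (IntegrableAtFilter.eq_zero_of_tendsto (μ := volume)
    ⟨Set.univ, univ_mem, hF.integrableOn⟩ (fun s hs => ?_) hlim)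
  obtain ⟨b, hb⟩ := mem_atTop_sets.1 hs
  rw [← top_le_iff, ← Real.volume_Ici (a := b)]
  exact measure_mono hb

theorem integral_eq_zero (h : IsPrimitive F f) (hF : Integrable F) (hf : Integrable f) :
    ∫ x, f x = 0 := by
  rw [← intervalIntegral.integral_Iic_add_Ioi (b := 0) hf.integrableOn hf.integrableOn,
    h.integral_Iic_eq hF hf, h.integral_Ioi_eq hF hf, add_neg_cancel]

end NormedSpace

variable {F G f g : ℝ → ℂ}

protected theorem mul (hF : IsPrimitive F f) (hG : IsPrimitive G g) :
    IsPrimitive (fun x => F x * G x) (fun x => f x * G x + F x * g x) := by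
  refine of_absolutelyContinuousOnInterval (fun a b => ?_)
    ((hF.locallyIntegrable.mul_continuous hG.continuous).add
      (hG.locallyIntegrable.continuous_mul hF.continuous)) ?_
  · exact (hF.absolutelyContinuousOnInterval a b).smul (hG.absolutelyContinuousOnInterval a b)
  · filter_upwards [hF.ae_hasDerivAt, hG.ae_hasDerivAt] with x hFx hGx using hFx.mul hGx

protected theorem star (h : IsPrimitive F f) :
    IsPrimitive (fun x => star (F x)) (fun x => star (f x)) :=
  h.comp_continuousLinearMap Complex.conjCLE.toContinuousLinearMap

theorem sign_mul (h : IsPrimitive F f) (h0 : F 0 = 0) :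
    IsPrimitive (fun x => ((SignType.sign x : ℝ) : ℂ) * F x)
      (fun x => ((SignType.sign x : ℝ) : ℂ) * f x) where
  locallyIntegrable x :=
    let ⟨s, hs, hi⟩ := h.locallyIntegrable x
    ⟨s, hs, hi.bdd_mul (c := 1)
      (Complex.measurable_ofReal.comp measurable_sign).aestronglyMeasurable
      (Eventually.of_forall fun y => by simpa using abs_sign_le_one y)⟩
  eq_add x := by
    have hcongr : ∫ t in (0 : ℝ)..x, ((SignType.sign t : ℝ) : ℂ) * f t
        = ∫ t in (0 : ℝ)..x, ((SignType.sign x : ℝ) : ℂ) * f t := by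
      refine intervalIntegral.integral_congr_ae ?_
      filter_upwards [Measure.ae_ne volume 0] with t ht0 ht
      rw [sign_eq_of_mem_uIoc ht ht0]
    rw [hcongr, intervalIntegral.integral_const_mul, h.eq_add x, h0]
    ring

end IsPrimitive

/-! ### Test functions and the lemma of du Bois-Reymond -/

namespace IsTest

variable {η θ : ℝ → ℝ}

theorem continuous_ofReal (h : IsTest η) : Continuous fun x => ((η x : ℝ) : ℂ) :=
  Complex.continuous_ofReal.comp h.1.continuous

theorem hasCompactSupport_ofReal (h : IsTest η) : HasCompactSupport fun x => ((η x : ℝ) : ℂ) :=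
  h.2.comp_left (g := fun r : ℝ => (r : ℂ)) Complex.ofReal_zero

theorem integrable (h : IsTest η) : Integrable η :=
  h.1.continuous.integrable_of_hasCompactSupport h.2

theorem integrable_mul_of_locallyIntegrable (h : IsTest η) {f : ℝ → ℂ}
    (hf : LocallyIntegrable f) : Integrable fun x => ((η x : ℝ) : ℂ) * f x := by
  simpa using hf.integrable_smul_left_of_hasCompactSupport h.continuous_ofReal
    h.hasCompactSupport_ofReal

theorem sub_const_mul (hη : IsTest η) (hθ : IsTest θ) (m : ℝ) :
    IsTest fun x => η x - m * θ x :=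
  ⟨hη.1.sub (contDiff_const.mul hθ.1), hη.2.sub (hθ.2.mul_left (f := fun _ => m))⟩

theorem isPrimitive (h : IsTest η) :
    IsPrimitive (fun x => ((η x : ℝ) : ℂ)) (fun x => ((_root_.deriv η x : ℝ) : ℂ)) :=
  .of_hasDerivAt (fun x => (h.1.differentiable (by simp) x).hasDerivAt.ofReal_comp)
    h.deriv.continuous_ofReal

end IsTest

theorem IsPrimitive.integral_deriv_mul {F f : ℝ → ℂ} (h : IsPrimitive F f) {η : ℝ → ℝ}
    (hη : IsTest η) :
    ∫ x, ((deriv η x : ℝ) : ℂ) * F x = -∫ x, ((η x : ℝ) : ℂ) * f x := by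
  have hF := h.continuous.locallyIntegrable (μ := volume)
  have hderiv := hη.deriv.integrable_mul_of_locallyIntegrable hF
  have hmul := hη.integrable_mul_of_locallyIntegrable h.locallyIntegrable
  have hparts := (hη.isPrimitive.mul h).integral_eq_zero
    (hη.integrable_mul_of_locallyIntegrable hF) (hderiv.add hmul)
  rw [integral_add hderiv hmul] at hparts
  exact eq_neg_of_add_eq_zero_left hparts

theorem hasCompactSupport_integral_Iic {φ : ℝ → ℝ} (hφ : Integrable φ) (hc : HasCompactSupport φ)
    (h0 : ∫ x, φ x = 0) : HasCompactSupport fun x => ∫ t in Set.Iic x, φ t := by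
  obtain ⟨R, hR⟩ := hc.isCompact.isBounded.subset_closedBall 0
  have hzero : ∀ x, R < |x| → φ x = 0 := fun x hx => by
    by_contra hne
    have := hR (subset_tsupport _ hne)
    rw [mem_closedBall_zero_iff, Real.norm_eq_abs] at this
    exact this.not_gt hx
  refine HasCompactSupport.intro (isCompact_closedBall (0 : ℝ) R) fun x hx => ?_
  rw [mem_closedBall_zero_iff, Real.norm_eq_abs, not_le] at hx
  rcases le_or_gt x 0 with hx0 | hx0
  · refine setIntegral_eq_zero_of_forall_eq_zero fun t (ht : t ≤ x) => hzero t ?_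
    exact hx.trans_le (by rw [abs_of_nonpos hx0, abs_of_nonpos (ht.trans hx0)]; linarith)
  · have hIoi : ∫ t in Set.Ioi x, φ t = 0 :=
      setIntegral_eq_zero_of_forall_eq_zero fun t (ht : x < t) => hzero t
        (hx.trans (by rwa [abs_of_pos hx0, abs_of_pos (hx0.trans ht)]))
    have hsum := intervalIntegral.integral_Iic_add_Ioi (b := x) hφ.integrableOn hφ.integrableOn
    rwa [h0, hIoi, add_zero] at hsum

theorem IsTest.exists_deriv_eq {φ : ℝ → ℝ} (hφ : IsTest φ) (h0 : ∫ x, φ x = 0) :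
    ∃ η : ℝ → ℝ, IsTest η ∧ _root_.deriv η = φ := by
  set η : ℝ → ℝ := fun x => ∫ t in Set.Iic x, φ t
  have hηφ : ∀ x, HasDerivAt η (φ x) x := fun x => by
    have hprim : η = fun y => (∫ t in Set.Iic 0, φ t) + ∫ t in (0 : ℝ)..y, φ t := by
      funext y
      rw [← intervalIntegral.integral_Iic_sub_Iic hφ.integrable.integrableOn
        hφ.integrable.integrableOn, add_sub_cancel]
    rw [hprim]
    exact (hφ.1.continuous.integral_hasStrictDerivAt 0 x).hasDerivAt.const_add _
  have hderiv : _root_.deriv η = φ := funext fun x => (hηφ x).deriv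
  refine ⟨η, ⟨?_, hasCompactSupport_integral_Iic hφ.integrable hφ.2 h0⟩, hderiv⟩
  rw [contDiff_infty_iff_deriv]
  exact ⟨fun x => (hηφ x).differentiableAt, hderiv ▸ hφ.1⟩

theorem exists_isTest_integral_eq_one : ∃ θ : ℝ → ℝ, IsTest θ ∧ ∫ x, θ x = 1 := by
  let b : ContDiffBump (0 : ℝ) := ⟨1, 2, one_pos, one_lt_two⟩
  exact ⟨b.normed volume, ⟨b.contDiff_normed, b.hasCompactSupport_normed⟩, b.integral_normed⟩

theorem ae_eq_const_of_integral_deriv_mul_eq_zero {h : ℝ → ℂ} (hh : LocallyIntegrable h)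
    (h0 : ∀ η, IsTest η → ∫ x, ((deriv η x : ℝ) : ℂ) * h x = 0) : ∃ c, h =ᵐ[volume] fun _ => c := by
  obtain ⟨θ, hθ, hθ1⟩ := exists_isTest_integral_eq_one
  refine ⟨∫ x, ((θ x : ℝ) : ℂ) * h x, ae_eq_of_integral_contDiff_smul_eq hh
    continuous_const.locallyIntegrable fun φ hsmooth hsupp => ?_⟩
  have hφ : IsTest φ := ⟨hsmooth, hsupp⟩
  -- `φ - (∫ φ) θ` has zero mean, hence is the derivative of a test function.
  obtain ⟨η, hη, hηd⟩ := (hφ.sub_const_mul hθ (∫ x, φ x)).exists_deriv_eq (by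
    rw [integral_sub hφ.integrable (hθ.integrable.const_mul _), integral_const_mul, hθ1,
      mul_one, sub_self])
  have hmean := h0 η hη
  simp only [hηd, Complex.ofReal_sub, Complex.ofReal_mul, sub_mul, mul_assoc] at hmean
  rw [integral_sub (hφ.integrable_mul_of_locallyIntegrable hh)
    ((hθ.integrable_mul_of_locallyIntegrable hh).const_mul _), integral_const_mul,
    sub_eq_zero] at hmean
  rw [integral_smul_const, Complex.real_smul, ← hmean]
  simp only [Complex.real_smul]

theorem exists_isPrimitive_ae_eq {f g : ℝ → ℂ} (hf : LocallyIntegrable f)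
    (hg : LocallyIntegrable g)
    (h : ∀ η, IsTest η → ∫ x, ((deriv η x : ℝ) : ℂ) * f x = -∫ x, ((η x : ℝ) : ℂ) * g x) :
    ∃ F, IsPrimitive F g ∧ f =ᵐ[volume] F := by
  have hG := IsPrimitive.integral hg
  have hGloc := hG.continuous.locallyIntegrable (μ := volume)
  obtain ⟨c, hc⟩ := ae_eq_const_of_integral_deriv_mul_eq_zero (hf.sub hGloc) fun η hη => by
    simp only [Pi.sub_apply, mul_sub]
    rw [integral_sub (hη.deriv.integrable_mul_of_locallyIntegrable hf)
      (hη.deriv.integrable_mul_of_locallyIntegrable hGloc), h η hη, hG.integral_deriv_mul hη,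
      sub_self]
  refine ⟨fun x => c + ∫ t in (0 : ℝ)..x, g t, ⟨hg, by simp⟩, ?_⟩
  filter_upwards [hc] with x hx
  rw [← hx, Pi.sub_apply, sub_add_cancel]

/-! ### Weak derivatives in `L²` -/

theorem L2.locallyIntegrable (f : L2 ℂ) : LocallyIntegrable f :=
  (Lp.memLp f).locallyIntegrable one_le_two

theorem L2.inner_eq_integral (f g : L2 ℂ) : ⟪f, g⟫_ℂ = ∫ x, star (f x) * g x := by
  rw [MeasureTheory.L2.inner_def]
  refine integral_congr_ae (Eventually.of_forall fun x => ?_)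
  simp only [RCLike.inner_apply, Complex.star_def]
  exact mul_comm _ _

theorem L2.integrable_star_mul (f g : L2 ℂ) : Integrable fun x => star (f x) * g x := by
  refine (MeasureTheory.L2.integrable_inner f g (𝕜 := ℂ)).congr (Eventually.of_forall fun x => ?_)
  simp only [RCLike.inner_apply, Complex.star_def]
  exact mul_comm _ _

theorem L2.inner_self (f : L2 ℂ) : ⟪f, f⟫_ℂ = ((‖f‖ ^ 2 : ℝ) : ℂ) := by
  rw [inner_self_eq_norm_sq_to_K]; push_cast; rfl

theorem IsWeakDeriv.exists_isPrimitive {f g : L2 ℂ} (h : IsWeakDeriv f g) :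
    ∃ F, IsPrimitive F g ∧ f =ᵐ[volume] F :=
  exists_isPrimitive_ae_eq f.locallyIntegrable g.locallyIntegrable h

theorem IsPrimitive.isWeakDeriv {F G : ℝ → ℂ} {f g : L2 ℂ} (h : IsPrimitive F G)
    (hf : f =ᵐ[volume] F) (hg : g =ᵐ[volume] G) : IsWeakDeriv f g := by
  intro η hη
  have hF : ∫ x, ((deriv η x : ℝ) : ℂ) * f x = ∫ x, ((deriv η x : ℝ) : ℂ) * F x :=
    integral_congr_ae (by filter_upwards [hf] with x hx; rw [hx])
  have hG : ∫ x, (η x : ℂ) * g x = ∫ x, (η x : ℂ) * G x :=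
    integral_congr_ae (by filter_upwards [hg] with x hx; rw [hx])
  rw [hF, hG]
  exact h.integral_deriv_mul hη

theorem IsWeakDeriv.inner_deriv_left {f f' g g' : L2 ℂ} (hf : IsWeakDeriv f f')
    (hg : IsWeakDeriv g g') : ⟪f', g⟫_ℂ = -⟪f, g'⟫_ℂ := by
  obtain ⟨F, hF, hfF⟩ := hf.exists_isPrimitive
  obtain ⟨G, hG, hgG⟩ := hg.exists_isPrimitive
  have hint := (L2.integrable_star_mul f g).congr (g := fun x => star (F x) * G x) (by
    filter_upwards [hfF, hgG] with x hfx hgx; rw [hfx, hgx])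
  have hf'G : (fun x => star (f' x) * g x) =ᵐ[volume] fun x => star (f' x) * G x := by
    filter_upwards [hgG] with x hfx; rw [hfx]
  have hFg' : (fun x => star (f x) * g' x) =ᵐ[volume] fun x => star (F x) * g' x := by
    filter_upwards [hfF] with x hfx; rw [hfx]
  have hint' := (L2.integrable_star_mul f' g).congr hf'G
  have hint'' := (L2.integrable_star_mul f g').congr hFg'
  have := (hF.star.mul hG).integral_eq_zero hint (hint'.add hint'')
  rw [integral_add hint' hint''] at this
  rw [L2.inner_eq_integral, L2.inner_eq_integral, integral_congr_ae hf'G, integral_congr_ae hFg']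
  linear_combination this

theorem L2.norm_sq_eq_integral (f : L2 ℂ) : ‖f‖ ^ 2 = ∫ x, ‖f x‖ ^ 2 := by
  have h := L2.inner_eq_integral f f
  rw [L2.inner_self] at h
  have hsq : ∀ x, star (f x) * f x = ((‖f x‖ ^ 2 : ℝ) : ℂ) := fun x => by
    rw [Complex.star_def, Complex.conj_mul']; push_cast; rfl
  simp only [hsq] at h
  rw [integral_complex_ofReal] at h
  exact Complex.ofReal_injective h

theorem L2.integral_norm_mul_norm_le (f g : L2 ℂ) : ∫ x, ‖f x‖ * ‖g x‖ ≤ ‖f‖ * ‖g‖ := by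
  have h := integral_mul_norm_le_Lp_mul_Lq (μ := volume) (f := f) (g := g)
    (p := 2) (q := 2) (by constructor <;> norm_num)
    (by simpa using Lp.memLp f) (by simpa using Lp.memLp g)
  have hnorm : ∀ k : L2 ℂ, (∫ x, ‖k x‖ ^ (2 : ℝ)) ^ (1 / 2 : ℝ) = ‖k‖ := fun k => by
    have : ∫ x, ‖k x‖ ^ (2 : ℝ) = ‖k‖ ^ 2 := by
      rw [L2.norm_sq_eq_integral]; norm_cast
    rw [this, ← Real.sqrt_eq_rpow, Real.sqrt_sq (norm_nonneg _)]
  rwa [hnorm, hnorm] at h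

theorem IsPrimitive.norm_sq_le {F : ℝ → ℂ} {f f' : L2 ℂ} (hF : IsPrimitive F f')
    (hf : f =ᵐ[volume] F) (x : ℝ) : ‖F x‖ ^ 2 ≤ 2 * ‖f‖ * ‖f'‖ := by
  have hint := (L2.integrable_star_mul f f).congr (g := fun x => star (F x) * F x) (by
    filter_upwards [hf] with x hfx; rw [hfx])
  have hint' := (L2.integrable_star_mul f' f).congr (g := fun x => star (f' x) * F x) (by
    filter_upwards [hf] with x hfx; rw [hfx])
  have hint'' := (L2.integrable_star_mul f f').congr (g := fun x => star (F x) * f' x) (by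
    filter_upwards [hf] with x hfx; rw [hfx])
  have hftc := (hF.star.mul hF).integral_Iic_eq hint (hint'.add hint'') x
  have hsq : ‖F x‖ ^ 2 = ‖star (F x) * F x‖ := by simp [sq]
  have hintNorm : Integrable fun x => 2 * (‖f x‖ * ‖f' x‖) := by
    have := (L2.integrable_star_mul f f').norm
    simp only [norm_mul, norm_star] at this
    exact this.const_mul 2
  rw [hsq, ← hftc]
  calc ‖∫ t in Set.Iic x, (star (f' t) * F t + star (F t) * f' t)‖
      ≤ ∫ t in Set.Iic x, ‖star (f' t) * F t + star (F t) * f' t‖ :=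
        norm_integral_le_integral_norm _
    _ ≤ ∫ t, ‖star (f' t) * F t + star (F t) * f' t‖ :=
        setIntegral_le_integral (hint'.add hint'').norm
          (Eventually.of_forall fun _ => norm_nonneg _)
    _ ≤ ∫ t, 2 * (‖f t‖ * ‖f' t‖) := by
        refine integral_mono_ae (hint'.add hint'').norm hintNorm ?_
        filter_upwards [hf] with t ht
        rw [ht]
        refine (norm_add_le _ _).trans (le_of_eq ?_)
        simp only [norm_mul, norm_star]; ring
    _ = 2 * ∫ t, ‖f t‖ * ‖f' t‖ := integral_const_mul _ _
    _ ≤ 2 * ‖f‖ * ‖f'‖ := by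
        rw [mul_assoc]
        exact mul_le_mul_of_nonneg_left (L2.integral_norm_mul_norm_le f f') zero_le_two

/-! ### Test functions as elements of `L²` -/

theorem IsTest.memLp {η : ℝ → ℝ} (h : IsTest η) : MemLp (fun x => (η x : ℂ)) 2 volume :=
  h.continuous_ofReal.memLp_of_hasCompactSupport h.hasCompactSupport_ofReal

/-- The class of a test function in `L²`. -/
noncomputable def IsTest.toL2 {η : ℝ → ℝ} (h : IsTest η) : L2 ℂ := h.memLp.toLp _

theorem IsTest.coeFn_toL2 {η : ℝ → ℝ} (h : IsTest η) :
    h.toL2 =ᵐ[volume] fun x => (η x : ℂ) := h.memLp.coeFn_toLp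

theorem IsTest.inner_toL2 {η : ℝ → ℝ} (h : IsTest η) (f : L2 ℂ) :
    ⟪h.toL2, f⟫_ℂ = ∫ x, (η x : ℂ) * f x := by
  rw [L2.inner_eq_integral]
  refine integral_congr_ae ?_
  filter_upwards [h.coeFn_toL2] with x hx
  simp [hx]

theorem isWeakDeriv_iff {f g : L2 ℂ} : IsWeakDeriv f g ↔
    ∀ (η : ℝ → ℝ) (h : IsTest η), ⟪h.deriv.toL2, f⟫_ℂ = -⟪h.toL2, g⟫_ℂ := by
  refine forall₂_congr fun η h => ?_
  rw [h.inner_toL2, h.deriv.inner_toL2]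

theorem IsTest.isWeakDeriv {η : ℝ → ℝ} (h : IsTest η) : IsWeakDeriv h.toL2 h.deriv.toL2 :=
  h.isPrimitive.isWeakDeriv h.coeFn_toL2 h.deriv.coeFn_toL2

theorem L2.eq_zero_of_inner_test {f : L2 ℂ}
    (hf : ∀ (η : ℝ → ℝ) (h : IsTest η), ⟪h.toL2, f⟫_ℂ = 0) : f = 0 := by
  refine (Lp.eq_zero_iff_ae_eq_zero).2 ?_
  refine ae_eq_zero_of_integral_contDiff_smul_eq_zero f.locallyIntegrable fun g hsmooth hsupp => ?_
  have hg : IsTest g := ⟨hsmooth, hsupp⟩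
  have := hf g hg
  rw [hg.inner_toL2] at this
  simpa only [Complex.real_smul] using this

theorem IsWeakDeriv.unique {f g g' : L2 ℂ} (h : IsWeakDeriv f g) (h' : IsWeakDeriv f g') :
    g = g' := by
  rw [isWeakDeriv_iff] at h h'
  refine sub_eq_zero.1 (L2.eq_zero_of_inner_test fun η hη => ?_)
  rw [inner_sub_right]
  linear_combination h η hη - h' η hη

theorem IsWeakDeriv.neg {f g : L2 ℂ} (h : IsWeakDeriv f g) : IsWeakDeriv (-f) (-g) := by
  simpa only [neg_smul, one_smul] using h.smul (-1)

theorem IsWeakDeriv.sub {f g f' g' : L2 ℂ} (h : IsWeakDeriv f g) (h' : IsWeakDeriv f' g') :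
    IsWeakDeriv (f - f') (g - g') := by
  rw [sub_eq_add_neg, sub_eq_add_neg]
  exact h.add h'.neg

theorem IsWeakDeriv.eq_zero_of_deriv_deriv_eq_smul {f f' : L2 ℂ} {c : ℝ} (hc : 0 < c)
    (h : IsWeakDeriv f f') (h' : IsWeakDeriv f' ((c : ℂ) • f)) : f = 0 := by
  have hparts := h.inner_deriv_left h'
  rw [inner_smul_right, L2.inner_self, L2.inner_self] at hparts
  have : ‖f'‖ ^ 2 = -(c * ‖f‖ ^ 2) := by exact_mod_cast hparts
  have hzero : ‖f‖ ^ 2 = 0 := by nlinarith [sq_nonneg ‖f'‖, sq_nonneg ‖f‖]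
  simpa using hzero

/-! ### The graph of the derivative -/

/-- The graph of `a⁻¹ D` in `L² × L²`, where `D` is the weak derivative: the pairs `(f, g)` with
`D f = a g`. The case `a = 1` is the space `H¹`; large `a` is used for mollification. -/
def scaledGraph (a : ℝ) : Submodule ℂ (WithLp 2 (L2 ℂ × L2 ℂ)) where
  carrier := {p | IsWeakDeriv p.fst ((a : ℂ) • p.snd)}
  add_mem' {p q} hp hq := by
    simpa only [Set.mem_ofPred_eq, WithLp.add_fst, WithLp.add_snd, smul_add]
      using IsWeakDeriv.add hp hq
  zero_mem' := by
    simpa only [Set.mem_ofPred_eq, WithLp.zero_fst, WithLp.zero_snd, smul_zero]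
      using IsWeakDeriv.zero
  smul_mem' c p hp := by
    simpa only [Set.mem_ofPred_eq, WithLp.smul_fst, WithLp.smul_snd, smul_comm c]
      using IsWeakDeriv.smul c hp

theorem isClosed_scaledGraph (a : ℝ) :
    IsClosed (scaledGraph a : Set (WithLp 2 (L2 ℂ × L2 ℂ))) := by
  have : (scaledGraph a : Set (WithLp 2 (L2 ℂ × L2 ℂ))) =
      ⋂ (η : ℝ → ℝ), ⋂ (h : IsTest η),
        {p | ⟪h.deriv.toL2, p.fst⟫_ℂ = -⟪h.toL2, (a : ℂ) • p.snd⟫_ℂ} := by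
    ext p
    simp only [Set.mem_iInter, Set.mem_ofPred_eq, ← isWeakDeriv_iff]
    rfl
  rw [this]
  refine isClosed_iInter fun η => isClosed_iInter fun h => isClosed_eq ?_ ?_
  · exact Continuous.inner (𝕜 := ℂ) continuous_const (WithLp.prod_continuous_ofLp _ _ _).fst
  · exact (Continuous.inner (𝕜 := ℂ) continuous_const
      ((WithLp.prod_continuous_ofLp _ _ _).snd.const_smul (a : ℂ))).neg

instance (a : ℝ) : CompleteSpace (scaledGraph a) := (isClosed_scaledGraph a).completeSpace_coe

theorem scaledGraph_one : scaledGraph 1 = H1 := by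
  ext p
  change IsWeakDeriv p.fst (((1 : ℝ) : ℂ) • p.snd) ↔ IsWeakDeriv p.fst p.snd
  rw [Complex.ofReal_one, one_smul]

instance : CompleteSpace H1 := scaledGraph_one ▸ inferInstance

/-! ### The space `H¹` -/

namespace H1

/-- The weak derivative of an element of `H¹`. -/
noncomputable def weakDeriv (f : H1) : L2 ℂ := f.1.snd

theorem isWeakDeriv (f : H1) : IsWeakDeriv (toL2 f) (weakDeriv f) := f.2

/-- The element of `H¹` given by a function and its weak derivative. -/
noncomputable def mk (f g : L2 ℂ) (h : IsWeakDeriv f g) : H1 := ⟨WithLp.toLp 2 (f, g), h⟩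

@[simp] theorem toL2_mk (f g : L2 ℂ) (h : IsWeakDeriv f g) : toL2 (mk f g h) = f := rfl

@[simp] theorem weakDeriv_mk (f g : L2 ℂ) (h : IsWeakDeriv f g) : weakDeriv (mk f g h) = g := rfl

/-- The inclusion of `H¹` in `L²`, as a continuous linear map. -/
noncomputable def toL2CLM : H1 →L[ℂ] L2 ℂ := (WithLp.fstL 2 ℂ (L2 ℂ) (L2 ℂ)).comp H1.subtypeL

/-- The weak derivative as a continuous linear map from `H¹` to `L²`. -/
noncomputable def weakDerivCLM : H1 →L[ℂ] L2 ℂ :=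
  (WithLp.sndL 2 ℂ (L2 ℂ) (L2 ℂ)).comp H1.subtypeL

@[simp] theorem toL2CLM_apply (f : H1) : toL2CLM f = toL2 f := rfl

@[simp] theorem weakDerivCLM_apply (f : H1) : weakDerivCLM f = weakDeriv f := rfl

theorem norm_sq (f : H1) : ‖f‖ ^ 2 = ‖toL2 f‖ ^ 2 + ‖weakDeriv f‖ ^ 2 :=
  WithLp.prod_norm_sq_eq_of_L2 (f : WithLp 2 (L2 ℂ × L2 ℂ))

theorem inner_def (f g : H1) : ⟪f, g⟫_ℂ = ⟪toL2 f, toL2 g⟫_ℂ + ⟪weakDeriv f, weakDeriv g⟫_ℂ :=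
  WithLp.prod_inner_apply _ _

theorem norm_toL2_le (f : H1) : ‖toL2 f‖ ≤ ‖f‖ :=
  le_of_sq_le_sq (by linarith [norm_sq f, sq_nonneg ‖weakDeriv f‖]) (norm_nonneg _)

theorem norm_weakDeriv_le (f : H1) : ‖weakDeriv f‖ ≤ ‖f‖ :=
  le_of_sq_le_sq (by linarith [norm_sq f, sq_nonneg ‖toL2 f‖]) (norm_nonneg _)

theorem tendsto_iff {α : Type*} {l : Filter α} {f : α → H1} {g : H1} :
    Tendsto f l (𝓝 g) ↔
      Tendsto (fun a => toL2 (f a)) l (𝓝 (toL2 g)) ∧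
        Tendsto (fun a => weakDeriv (f a)) l (𝓝 (weakDeriv g)) := by
  refine ⟨fun h => ⟨(toL2CLM.continuous.tendsto g).comp h,
    (weakDerivCLM.continuous.tendsto g).comp h⟩, fun ⟨h, h'⟩ => ?_⟩
  have hnorm : ∀ a, ‖f a - g‖ =
      √(‖toL2 (f a) - toL2 g‖ ^ 2 + ‖weakDeriv (f a) - weakDeriv g‖ ^ 2) := fun a => by
    rw [← Real.sqrt_sq (norm_nonneg (f a - g)), norm_sq]; rfl
  rw [tendsto_iff_norm_sub_tendsto_zero] at h h' ⊢
  simpa only [hnorm, zero_pow two_ne_zero, add_zero, Real.sqrt_zero]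
    using ((h.pow 2).add (h'.pow 2)).sqrt

theorem norm_le_of_isPrimitive (f : H1) {F : ℝ → ℂ} (hF : IsPrimitive F (weakDeriv f))
    (hf : toL2 f =ᵐ[volume] F) (x : ℝ) : ‖F x‖ ≤ ‖f‖ :=
  le_of_sq_le_sq (by
    linarith [hF.norm_sq_le hf x, norm_sq f, two_mul_le_add_sq ‖toL2 f‖ ‖weakDeriv f‖])
    (norm_nonneg _)

theorem ae_norm_le (f : H1) : ∀ᵐ x, ‖toL2 f x‖ ≤ ‖f‖ := by
  obtain ⟨F, hF, hf⟩ := (isWeakDeriv f).exists_isPrimitive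
  filter_upwards [hf] with x hx
  rw [hx]
  exact norm_le_of_isPrimitive f hF hf x

theorem memLp_top (f : H1) : MemLp (toL2 f) ∞ volume :=
  memLp_top_of_bound (Lp.memLp (toL2 f)).1 ‖f‖ (ae_norm_le f)

/-- The Sobolev embedding of `H¹` in `L^∞`. -/
noncomputable def toLinfty : H1 →L[ℂ] Lp ℂ ∞ (volume : Measure ℝ) :=
  LinearMap.mkContinuous
    { toFun := fun f => (memLp_top f).toLp _
      map_add' := fun f g => by
        rw [← MemLp.toLp_add, MemLp.toLp_eq_toLp_iff]
        exact Lp.coeFn_add (toL2 f) (toL2 g)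
      map_smul' := fun c f => by
        rw [RingHom.id_apply, ← MemLp.toLp_const_smul, MemLp.toLp_eq_toLp_iff]
        exact Lp.coeFn_smul c (toL2 f) } 1 fun f => by
        rw [one_mul, LinearMap.coe_mk, AddHom.coe_mk, Lp.norm_toLp, eLpNorm_exponent_top]
        exact ENNReal.toReal_le_of_le_ofReal (norm_nonneg _)
          (eLpNormEssSup_le_of_ae_bound (ae_norm_le f))

theorem coeFn_toLinfty (f : H1) : toLinfty f =ᵐ[volume] toL2 f := (memLp_top f).coeFn_toLp

end H1

/-! ### Multiplication -/

/-- Multiplication of bounded functions with square integrable functions. -/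
noncomputable def linftyMul : Lp ℂ ∞ (volume : Measure ℝ) →L[ℂ] L2 ℂ →L[ℂ] L2 ℂ :=
  (ContinuousLinearMap.mul ℂ ℂ).holderL volume ∞ 2 2

theorem coeFn_linftyMul (φ : Lp ℂ ∞ (volume : Measure ℝ)) (f : L2 ℂ) :
    linftyMul φ f =ᵐ[volume] fun x => φ x * f x :=
  (ContinuousLinearMap.mul ℂ ℂ).coeFn_holder φ f

/-- Multiplication of a function in `H¹` with a function in `L²`. -/
noncomputable def H1.mul : H1 →L[ℂ] L2 ℂ →L[ℂ] L2 ℂ := linftyMul.comp H1.toLinfty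

theorem H1.coeFn_mul (f : H1) (g : L2 ℂ) : H1.mul f g =ᵐ[volume] fun x => H1.toL2 f x * g x := by
  filter_upwards [coeFn_linftyMul (H1.toLinfty f) g, H1.coeFn_toLinfty f] with x hmul hf
  rw [← hf]; exact hmul

theorem H1.norm_mul_le (f : H1) (g : L2 ℂ) : ‖H1.mul f g‖ ≤ ‖f‖ * ‖g‖ := by
  refine Lp.norm_le_mul_norm_of_ae_le_mul ?_
  filter_upwards [H1.coeFn_mul f g, H1.ae_norm_le f] with x hmul hle
  rw [hmul, norm_mul]
  gcongr

/-- A bounded measurable weight. -/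
structure Weight where
  toFun : ℝ → ℝ
  measurable : Measurable toFun
  bound : ∃ C, ∀ x, |toFun x| ≤ C

namespace Weight

instance : CoeFun Weight fun _ => ℝ → ℝ := ⟨Weight.toFun⟩

theorem memLp (φ : Weight) : MemLp (fun x => (φ x : ℂ)) ∞ volume := by
  obtain ⟨C, hC⟩ := φ.bound
  exact memLp_top_of_bound (Complex.measurable_ofReal.comp φ.measurable).aestronglyMeasurable C
    (Eventually.of_forall fun x => by simpa using hC x)

/-- Multiplication with a weight, as an operator on `L²`. -/
noncomputable def mul (φ : Weight) : L2 ℂ →L[ℂ] L2 ℂ := linftyMul (φ.memLp.toLp _)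

theorem coeFn_mul (φ : Weight) (f : L2 ℂ) :
    φ.mul f =ᵐ[volume] fun x => (φ x : ℂ) * f x := by
  filter_upwards [coeFn_linftyMul (φ.memLp.toLp _) f, φ.memLp.coeFn_toLp] with x hmul hφ
  rw [← hφ]; exact hmul

theorem norm_mul_le (φ : Weight) {C : ℝ} (hC : ∀ x, |φ x| ≤ C) (f : L2 ℂ) :
    ‖φ.mul f‖ ≤ C * ‖f‖ := by
  refine Lp.norm_le_mul_norm_of_ae_le_mul ?_
  filter_upwards [φ.coeFn_mul f] with x hmul
  rw [hmul, norm_mul, Complex.norm_real, Real.norm_eq_abs]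
  gcongr
  exact hC x

theorem inner_mul_left (φ : Weight) (f g : L2 ℂ) : ⟪φ.mul f, g⟫_ℂ = ⟪f, φ.mul g⟫_ℂ := by
  rw [L2.inner_eq_integral, L2.inner_eq_integral]
  refine integral_congr_ae ?_
  filter_upwards [φ.coeFn_mul f, φ.coeFn_mul g] with x hf hg
  rw [hf, hg]
  simp only [Complex.star_def, map_mul, Complex.conj_ofReal]
  ring

protected theorem mul_mul (φ χ κ : Weight) (h : ∀ x, φ x * χ x = κ x) (f : L2 ℂ) :
    φ.mul (χ.mul f) = κ.mul f := by
  refine Lp.ext ?_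
  filter_upwards [φ.coeFn_mul (χ.mul f), χ.coeFn_mul f, κ.coeFn_mul f] with x hφχ hχ hκ
  rw [hφχ, hχ, hκ, ← h x]
  push_cast; ring

protected theorem mul_left_comm (φ χ : Weight) (f : L2 ℂ) : φ.mul (χ.mul f) = χ.mul (φ.mul f) := by
  refine Lp.ext ?_
  filter_upwards [φ.coeFn_mul (χ.mul f), χ.coeFn_mul f, χ.coeFn_mul (φ.mul f), φ.coeFn_mul f]
    with x hφχ hχ hχφ hφ
  rw [hφχ, hχ, hχφ, hφ]
  ring

/-- The second weight is the derivative of the first one. -/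
def HasDeriv (φ φ' : Weight) : Prop :=
  IsPrimitive (fun x => (φ x : ℂ)) (fun x => (φ' x : ℂ))

theorem HasDeriv.isWeakDeriv {φ φ' : Weight} (h : φ.HasDeriv φ') {f g : L2 ℂ}
    (hf : IsWeakDeriv f g) : IsWeakDeriv (φ.mul f) (φ'.mul f + φ.mul g) := by
  obtain ⟨F, hF, hfF⟩ := hf.exists_isPrimitive
  refine (IsPrimitive.mul h hF).isWeakDeriv ?_ ?_
  · filter_upwards [φ.coeFn_mul f, hfF] with x hmul hx
    rw [hmul, hx]
  · filter_upwards [Lp.coeFn_add (φ'.mul f) (φ.mul g), φ'.coeFn_mul f, φ.coeFn_mul g, hfF]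
      with x hadd hφ' hφ hx
    rw [hadd, Pi.add_apply, hφ', hφ, hx]

end Weight

/-- Complex conjugation on `L²`. -/
noncomputable def L2.conj : L2 ℂ →L[ℝ] L2 ℂ :=
  Complex.conjCLE.toContinuousLinearMap.compLpL 2 volume

theorem L2.coeFn_conj (f : L2 ℂ) : L2.conj f =ᵐ[volume] fun x => star (f x) :=
  Complex.conjCLE.toContinuousLinearMap.coeFn_compLpL f

theorem L2.inner_conj_conj (f g : L2 ℂ) : ⟪L2.conj f, L2.conj g⟫_ℂ = ⟪g, f⟫_ℂ := by
  rw [L2.inner_eq_integral, L2.inner_eq_integral]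
  refine integral_congr_ae ?_
  filter_upwards [L2.coeFn_conj f, L2.coeFn_conj g] with x hf hg
  rw [hf, hg, star_star, mul_comm]

theorem L2.norm_conj (f : L2 ℂ) : ‖L2.conj f‖ = ‖f‖ := by
  have h := L2.inner_conj_conj f f
  rw [L2.inner_self, L2.inner_self, Complex.ofReal_inj] at h
  exact (pow_left_inj₀ (norm_nonneg _) (norm_nonneg _) two_ne_zero).1 h

theorem IsWeakDeriv.conj {f g : L2 ℂ} (h : IsWeakDeriv f g) :
    IsWeakDeriv (L2.conj f) (L2.conj g) := by
  obtain ⟨F, hF, hfF⟩ := h.exists_isPrimitive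
  refine hF.star.isWeakDeriv ?_ (L2.coeFn_conj g)
  filter_upwards [L2.coeFn_conj f, hfF] with x hconj hx
  rw [hconj, hx]

theorem H1.isWeakDeriv_mul (f g : H1) :
    IsWeakDeriv (H1.mul f (H1.toL2 g)) (H1.mul f (H1.weakDeriv g) + H1.mul g (H1.weakDeriv f)) := by
  obtain ⟨F, hF, hfF⟩ := (H1.isWeakDeriv f).exists_isPrimitive
  obtain ⟨G, hG, hgG⟩ := (H1.isWeakDeriv g).exists_isPrimitive
  refine (hF.mul hG).isWeakDeriv ?_ ?_
  · filter_upwards [H1.coeFn_mul f (H1.toL2 g), hfF, hgG] with x hmul hfx hgx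
    rw [hmul, hfx, hgx]
  · filter_upwards [Lp.coeFn_add (H1.mul f (H1.weakDeriv g)) (H1.mul g (H1.weakDeriv f)),
      H1.coeFn_mul f (H1.weakDeriv g), H1.coeFn_mul g (H1.weakDeriv f), hfF, hgG]
      with x hadd hfg' hgf' hfx hgx
    rw [hadd, Pi.add_apply, hfg', hgf', hfx, hgx]
    ring

/-! ### Density of test functions -/

/-- A test function as an element of `H¹`. -/
noncomputable def IsTest.toH1 {η : ℝ → ℝ} (h : IsTest η) : H1 :=
  H1.mk h.toL2 h.deriv.toL2 h.isWeakDeriv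

theorem H1.eq_zero_of_inner_test {f : H1}
    (hf : ∀ (η : ℝ → ℝ) (h : IsTest η), ⟪h.toH1, f⟫_ℂ = 0) : f = 0 := by
  have hderiv : IsWeakDeriv (H1.weakDeriv f) (((1 : ℝ) : ℂ) • H1.toL2 f) := by
    rw [isWeakDeriv_iff]
    intro η hη
    have := hf η hη
    rw [H1.inner_def] at this
    simp only [IsTest.toH1, H1.toL2_mk, H1.weakDeriv_mk] at this
    rw [Complex.ofReal_one, one_smul]
    linear_combination this
  have hzero := (H1.isWeakDeriv f).eq_zero_of_deriv_deriv_eq_smul one_pos hderiv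
  have hzero' : H1.weakDeriv f = 0 := (hzero ▸ H1.isWeakDeriv f).unique IsWeakDeriv.zero
  have hnorm := H1.norm_sq f
  rw [hzero, hzero'] at hnorm
  simpa using hnorm

theorem H1.test_induction {p : H1 → Prop}
    (test : ∀ (η : ℝ → ℝ) (h : IsTest η), p h.toH1)
    (zero : p 0) (add : ∀ f g, p f → p g → p (f + g)) (smul : ∀ (c : ℂ) f, p f → p (c • f))
    (closed : IsClosed {f | p f}) (f : H1) : p f := by
  let K : Submodule ℂ H1 := Submodule.span ℂ {f | ∃ (η : ℝ → ℝ) (h : IsTest η), f = h.toH1}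
  have hK : K.topologicalClosure = ⊤ := by
    rw [Submodule.topologicalClosure_eq_top_iff, Submodule.eq_bot_iff]
    exact fun g hg => H1.eq_zero_of_inner_test fun η hη =>
      (Submodule.mem_orthogonal K g).1 hg hη.toH1 (Submodule.subset_span ⟨η, hη, rfl⟩)
  have hf : f ∈ K.topologicalClosure := hK ▸ Submodule.mem_top
  refine closure_minimal (fun g hg => ?_) closed hf
  induction hg using Submodule.span_induction with
  | mem _ hg => obtain ⟨η, h, rfl⟩ := hg; exact test η h
  | zero => exact zero
  | add f g _ _ hf hg => exact add f g hf hg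
  | smul c f _ hf => exact smul c f hf

theorem H1.denseRange_toL2 : DenseRange H1.toL2CLM := by
  have htop : (LinearMap.range (H1.toL2CLM : H1 →ₗ[ℂ] L2 ℂ)).topologicalClosure = ⊤ := by
    rw [Submodule.topologicalClosure_eq_top_iff, Submodule.eq_bot_iff]
    exact fun h hh => L2.eq_zero_of_inner_test fun η hη =>
      (Submodule.mem_orthogonal _ h).1 hh _ ⟨hη.toH1, rfl⟩
  exact Submodule.dense_iff_topologicalClosure_eq_top.2 htop

/-! ### Mollification by the resolvent of the Laplacian -/

/-- The frequency scale of the `k`-th mollifier. -/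
noncomputable def freq (k : ℕ) : ℝ := k + 1

theorem freq_pos (k : ℕ) : 0 < freq k := Nat.cast_add_one_pos k

theorem freq_ne_zero (k : ℕ) : (freq k : ℂ) ≠ 0 := Complex.ofReal_ne_zero.2 (freq_pos k).ne'

theorem tendsto_inv_freq : Tendsto (fun k => (freq k)⁻¹) atTop (𝓝 0) := by
  simpa only [freq, one_div] using tendsto_one_div_add_atTop_nhds_zero_nat (𝕜 := ℝ)

/-- The first component of `scaledGraph a`, as a contraction into `L²`. -/
noncomputable def scaledGraphFst (a : ℝ) : scaledGraph a →L[ℂ] L2 ℂ :=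
  (WithLp.fstL 2 ℂ (L2 ℂ) (L2 ℂ)).comp (scaledGraph a).subtypeL

theorem norm_sq_scaledGraph {a : ℝ} (p : scaledGraph a) :
    ‖p‖ ^ 2 = ‖p.1.fst‖ ^ 2 + ‖p.1.snd‖ ^ 2 :=
  WithLp.prod_norm_sq_eq_of_L2 p.1

theorem norm_scaledGraphFst_le (a : ℝ) : ‖scaledGraphFst a‖ ≤ 1 :=
  ContinuousLinearMap.opNorm_le_bound _ zero_le_one fun p => by
    rw [one_mul]
    change ‖p.1.fst‖ ≤ ‖p‖
    exact le_of_sq_le_sq (by linarith [norm_sq_scaledGraph p, sq_nonneg ‖p.1.snd‖])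
      (norm_nonneg _)

/-- The pair `(f_k, freq k⁻¹ D f_k)`, where `f_k = (1 - freq k⁻² D²)⁻¹ f`. By the Riesz
representation theorem, the adjoint of the inclusion of the graph solves this equation weakly. -/
noncomputable def mollifyGraph (k : ℕ) : L2 ℂ →L[ℂ] scaledGraph (freq k) :=
  (scaledGraphFst (freq k)).adjoint

/-- The mollifier `(1 - freq k⁻² D²)⁻¹`, an approximation of the identity which commutes
with `D`. -/
noncomputable def mollify (k : ℕ) : L2 ℂ →L[ℂ] L2 ℂ :=
  (scaledGraphFst (freq k)).comp (mollifyGraph k)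

/-- The derivative `D (1 - freq k⁻² D²)⁻¹` of the mollifier, a bounded operator. -/
noncomputable def mollifyDeriv (k : ℕ) : L2 ℂ →L[ℂ] L2 ℂ :=
  (freq k : ℂ) • ((WithLp.sndL 2 ℂ (L2 ℂ) (L2 ℂ)).comp
    (scaledGraph (freq k)).subtypeL).comp (mollifyGraph k)

/-- The second derivative `D² (1 - freq k⁻² D²)⁻¹` of the mollifier, a bounded operator. -/
noncomputable def mollifyDeriv₂ (k : ℕ) : L2 ℂ →L[ℂ] L2 ℂ :=
  ((freq k ^ 2 : ℝ) : ℂ) • (mollify k - ContinuousLinearMap.id ℂ (L2 ℂ))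

theorem mollifyDeriv₂_apply (k : ℕ) (f : L2 ℂ) :
    mollifyDeriv₂ k f = ((freq k ^ 2 : ℝ) : ℂ) • (mollify k f - f) := rfl

theorem eq_mollify_sub (k : ℕ) (f : L2 ℂ) :
    f = mollify k f - (((freq k)⁻¹ ^ 2 : ℝ) : ℂ) • mollifyDeriv₂ k f := by
  rw [mollifyDeriv₂_apply, smul_smul, ← Complex.ofReal_mul, ← mul_pow,
    inv_mul_cancel₀ (freq_pos k).ne', one_pow, Complex.ofReal_one, one_smul, sub_sub_cancel]

theorem isWeakDeriv_mollify (k : ℕ) (f : L2 ℂ) : IsWeakDeriv (mollify k f) (mollifyDeriv k f) :=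
  (mollifyGraph k f).2

theorem norm_mollifyGraph_le (k : ℕ) (f : L2 ℂ) : ‖mollifyGraph k f‖ ≤ ‖f‖ := by
  refine ((mollifyGraph k).le_of_opNorm_le (c := 1) ?_ f).trans_eq (one_mul _)
  rw [mollifyGraph, LinearIsometryEquiv.norm_map]
  exact norm_scaledGraphFst_le _

theorem norm_mollify_le (k : ℕ) (f : L2 ℂ) : ‖mollify k f‖ ≤ ‖f‖ :=
  ((scaledGraphFst (freq k)).le_of_opNorm_le (norm_scaledGraphFst_le _) _).trans
    ((one_mul _).trans_le (norm_mollifyGraph_le k f))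

theorem norm_mollifyDeriv_le (k : ℕ) (f : L2 ℂ) : ‖mollifyDeriv k f‖ ≤ freq k * ‖f‖ := by
  have hsnd (p : scaledGraph (freq k)) : ‖p.1.snd‖ ≤ ‖p‖ :=
    le_of_sq_le_sq (by linarith [norm_sq_scaledGraph p, sq_nonneg ‖p.1.fst‖]) (norm_nonneg _)
  calc ‖mollifyDeriv k f‖ = ‖(freq k : ℂ)‖ * ‖(mollifyGraph k f).1.snd‖ :=
        norm_smul (freq k : ℂ) (mollifyGraph k f).1.snd
    _ = freq k * ‖(mollifyGraph k f).1.snd‖ := by rw [Complex.norm_of_nonneg (freq_pos k).le]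
    _ ≤ freq k * ‖f‖ := mul_le_mul_of_nonneg_left ((hsnd _).trans (norm_mollifyGraph_le k f))
        (freq_pos k).le

theorem inner_mollify_left (k : ℕ) (f g : L2 ℂ) : ⟪mollify k f, g⟫_ℂ = ⟪f, mollify k g⟫_ℂ :=
  ((scaledGraphFst (freq k)).adjoint_inner_right (mollifyGraph k f) g).symm.trans
    ((scaledGraphFst (freq k)).adjoint_inner_left (mollifyGraph k g) f)

theorem inner_mollifyDeriv_eq (k : ℕ) (f : L2 ℂ) {g g' : L2 ℂ} (h : IsWeakDeriv g g') :
    ⟪mollifyDeriv k f, g'⟫_ℂ = -⟪mollifyDeriv₂ k f, g⟫_ℂ := by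
  let p : scaledGraph (freq k) := ⟨WithLp.toLp 2 (g, (freq k : ℂ)⁻¹ • g'), by
    change IsWeakDeriv g ((freq k : ℂ) • (freq k : ℂ)⁻¹ • g')
    rwa [smul_inv_smul₀ (freq_ne_zero k)]⟩
  have hadj : ⟪mollifyGraph k f, p⟫_ℂ = ⟪f, g⟫_ℂ :=
    (scaledGraphFst (freq k)).adjoint_inner_left p f
  have hprod : ⟪mollifyGraph k f, p⟫_ℂ
      = ⟪mollify k f, g⟫_ℂ + ⟪(mollifyGraph k f).1.snd, (freq k : ℂ)⁻¹ • g'⟫_ℂ :=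
    WithLp.prod_inner_apply _ _
  have hderiv : ⟪mollifyDeriv k f, g'⟫_ℂ = freq k * ⟪(mollifyGraph k f).1.snd, g'⟫_ℂ := by
    rw [← Complex.conj_ofReal, ← inner_smul_left]; rfl
  rw [hadj, inner_smul_right] at hprod
  rw [hderiv, mollifyDeriv₂_apply, inner_smul_left, inner_sub_left, hprod, Complex.conj_ofReal]
  have := freq_ne_zero k
  push_cast
  field_simp
  ring

theorem isWeakDeriv_mollifyDeriv (k : ℕ) (f : L2 ℂ) :
    IsWeakDeriv (mollifyDeriv k f) (mollifyDeriv₂ k f) := by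
  rw [isWeakDeriv_iff]
  intro η hη
  have h := congrArg (starRingEnd ℂ) (inner_mollifyDeriv_eq k f hη.isWeakDeriv)
  rwa [map_neg, inner_conj_symm, inner_conj_symm] at h

theorem inner_mollifyDeriv_left (k : ℕ) (f g : L2 ℂ) :
    ⟪mollifyDeriv k f, g⟫_ℂ = -⟪f, mollifyDeriv k g⟫_ℂ := by
  conv_lhs => rw [eq_mollify_sub k g]
  conv_rhs => rw [eq_mollify_sub k f]
  have h := (isWeakDeriv_mollify k f).inner_deriv_left (isWeakDeriv_mollify k g)
  have h' := (isWeakDeriv_mollifyDeriv k f).inner_deriv_left (isWeakDeriv_mollifyDeriv k g)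
  simp only [inner_sub_left, inner_sub_right, inner_smul_left, inner_smul_right,
    Complex.conj_ofReal]
  linear_combination h - (((freq k)⁻¹ ^ 2 : ℝ) : ℂ) * h'

theorem inner_mollifyDeriv₂_left (k : ℕ) (f g : L2 ℂ) :
    ⟪mollifyDeriv₂ k f, g⟫_ℂ = ⟪f, mollifyDeriv₂ k g⟫_ℂ := by
  rw [mollifyDeriv₂_apply, mollifyDeriv₂_apply, inner_smul_left, inner_smul_right,
    inner_sub_left, inner_sub_right, inner_mollify_left, Complex.conj_ofReal]

theorem IsWeakDeriv.mollifyDeriv_eq {f f' : L2 ℂ} (h : IsWeakDeriv f f') (k : ℕ) :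
    mollifyDeriv k f = mollify k f' := by
  have hd := (isWeakDeriv_mollifyDeriv k f).sub (isWeakDeriv_mollify k f')
  have hdd : IsWeakDeriv (mollifyDeriv₂ k f - mollifyDeriv k f')
      (((freq k ^ 2 : ℝ) : ℂ) • (mollifyDeriv k f - mollify k f')) := by
    have heq : ((freq k ^ 2 : ℝ) : ℂ) • (mollifyDeriv k f - mollify k f')
        = ((freq k ^ 2 : ℝ) : ℂ) • (mollifyDeriv k f - f') - mollifyDeriv₂ k f' := by
      rw [mollifyDeriv₂_apply, ← smul_sub, sub_sub_sub_cancel_right]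
    rw [heq]
    exact (((isWeakDeriv_mollify k f).sub h).smul _).sub (isWeakDeriv_mollifyDeriv k f')
  exact sub_eq_zero.1 (hd.eq_zero_of_deriv_deriv_eq_smul (pow_pos (freq_pos k) 2) hdd)

theorem IsWeakDeriv.mollifyDeriv₂_eq {f f' : L2 ℂ} (h : IsWeakDeriv f f') (k : ℕ) :
    mollifyDeriv₂ k f = mollifyDeriv k f' :=
  (isWeakDeriv_mollifyDeriv k f).unique (h.mollifyDeriv_eq k ▸ isWeakDeriv_mollify k f')

theorem IsWeakDeriv.norm_mollify_sub_le {f f' : L2 ℂ} (h : IsWeakDeriv f f') (k : ℕ) :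
    ‖mollify k f - f‖ ≤ (freq k)⁻¹ * ‖f'‖ := by
  have hinv := inv_pos.2 (freq_pos k)
  have heq : mollify k f - f = (((freq k)⁻¹ ^ 2 : ℝ) : ℂ) • mollifyDeriv k f' := by
    rw [sub_eq_iff_eq_add', ← sub_eq_iff_eq_add, ← h.mollifyDeriv₂_eq k]
    exact (eq_mollify_sub k f).symm
  rw [heq, norm_smul, Complex.norm_real, Real.norm_eq_abs, abs_of_pos (pow_pos hinv 2), sq,
    mul_assoc]
  refine mul_le_mul_of_nonneg_left ?_ hinv.le
  rw [inv_mul_le_iff₀ (freq_pos k)]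
  exact norm_mollifyDeriv_le k f'

theorem tendsto_mollify (f : L2 ℂ) : Tendsto (fun k => mollify k f) atTop (𝓝 f) := by
  rw [Metric.tendsto_atTop]
  intro ε hε
  obtain ⟨g, hg⟩ := H1.denseRange_toL2.exists_dist_lt f (show 0 < ε / 3 by positivity)
  rw [H1.toL2CLM_apply, dist_eq_norm] at hg
  have hlim : Tendsto (fun k => (freq k)⁻¹ * ‖H1.weakDeriv g‖) atTop (𝓝 0) := by
    simpa using tendsto_inv_freq.mul_const ‖H1.weakDeriv g‖
  obtain ⟨N, hN⟩ :=
    (hlim.eventually (gt_mem_nhds (show 0 < ε / 3 by positivity))).exists_forall_of_atTop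
  refine ⟨N, fun k hk => ?_⟩
  have hsplit : mollify k f - f = mollify k (f - H1.toL2 g)
      + (mollify k (H1.toL2 g) - H1.toL2 g) - (f - H1.toL2 g) := by
    rw [map_sub]; abel
  have hfg := norm_mollify_le k (f - H1.toL2 g)
  have hgk := (H1.isWeakDeriv g).norm_mollify_sub_le k
  calc dist (mollify k f) f
      ≤ ‖mollify k (f - H1.toL2 g)‖ + ‖mollify k (H1.toL2 g) - H1.toL2 g‖ + ‖f - H1.toL2 g‖ := by
        rw [dist_eq_norm, hsplit]
        exact (norm_sub_le _ _).trans (by gcongr; exact norm_add_le _ _)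
    _ < ε := by linarith [hN k hk]

/-- The mollifier, with values in `H¹`. -/
noncomputable def mollifyH1 (k : ℕ) (f : L2 ℂ) : H1 :=
  H1.mk (mollify k f) (mollifyDeriv k f) (isWeakDeriv_mollify k f)

theorem continuous_mollifyH1 (k : ℕ) : Continuous (mollifyH1 k) :=
  continuous_iff_continuousAt.2 fun f =>
    H1.tendsto_iff.2 ⟨(mollify k).continuous.tendsto f, (mollifyDeriv k).continuous.tendsto f⟩

theorem H1.weakDeriv_mollifyH1 (k : ℕ) (f : H1) :
    H1.weakDeriv (mollifyH1 k (H1.toL2 f)) = mollify k (H1.weakDeriv f) :=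
  (H1.isWeakDeriv f).mollifyDeriv_eq k

theorem tendsto_mollifyH1 (f : H1) : Tendsto (fun k => mollifyH1 k (H1.toL2 f)) atTop (𝓝 f) := by
  simp only [H1.tendsto_iff, H1.weakDeriv_mollifyH1]
  exact ⟨tendsto_mollify _, tendsto_mollify _⟩

theorem norm_mollifyH1_le (k : ℕ) (f : H1) : ‖mollifyH1 k (H1.toL2 f)‖ ≤ ‖f‖ := by
  refine le_of_sq_le_sq ?_ (norm_nonneg _)
  rw [H1.norm_sq, H1.norm_sq f, H1.weakDeriv_mollifyH1, mollifyH1, H1.toL2_mk]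
  gcongr <;> exact norm_mollify_le _ _

/-! ### The real inner product of `L²` -/

namespace L2

theorem real_inner_eq_integral (f g : L2 ℂ) : ⟪f, g⟫_ℝ = ∫ x, (star (f x) * g x).re := by
  rw [MeasureTheory.L2.inner_def]
  refine integral_congr_ae (Eventually.of_forall fun x => ?_)
  simp only [Complex.inner, Complex.star_def]
  rw [mul_comm]

theorem real_inner_eq_re (f g : L2 ℂ) : ⟪f, g⟫_ℝ = (⟪f, g⟫_ℂ).re := by
  rw [real_inner_eq_integral, inner_eq_integral]
  exact Complex.reCLM.integral_comp_comm (integrable_star_mul f g)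

theorem real_inner_I_smul_left (f g : L2 ℂ) : ⟪Complex.I • f, g⟫_ℝ = -⟪f, Complex.I • g⟫_ℝ := by
  rw [real_inner_eq_re, real_inner_eq_re, inner_smul_left, inner_smul_right, Complex.conj_I,
    neg_mul, Complex.neg_re]

theorem real_inner_I_smul_eq_zero_of_symm {A : L2 ℂ →L[ℂ] L2 ℂ}
    (hA : ∀ f g, ⟪A f, g⟫_ℝ = ⟪f, A g⟫_ℝ) (f : L2 ℂ) : ⟪A f, Complex.I • f⟫_ℝ = 0 := by
  have h := hA f (Complex.I • f)
  rw [map_smul] at h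
  have h' := real_inner_I_smul_left f (A f)
  rw [real_inner_comm] at h'
  linarith

theorem real_inner_I_smul_self (f : L2 ℂ) : ⟪f, Complex.I • f⟫_ℝ = 0 :=
  real_inner_I_smul_eq_zero_of_symm (A := ContinuousLinearMap.id ℂ _) (fun _ _ => rfl) f

end L2

theorem Weight.real_inner_mul_left (φ : Weight) (f g : L2 ℂ) :
    ⟪φ.mul f, g⟫_ℝ = ⟪f, φ.mul g⟫_ℝ := by
  rw [L2.real_inner_eq_re, φ.inner_mul_left, L2.real_inner_eq_re]

theorem Weight.abs_real_inner_mollify_le (φ : Weight) (k : ℕ) (f g : L2 ℂ) :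
    |⟪φ.mul (mollify k f), mollify k g⟫_ℝ| ≤ ‖φ.mul‖ * ‖f‖ * ‖g‖ :=
  (abs_real_inner_le_norm _ _).trans (mul_le_mul
    (φ.mul.le_of_opNorm_le_of_le le_rfl (norm_mollify_le k f)) (norm_mollify_le k g)
    (norm_nonneg _) (by positivity))

theorem Weight.tendsto_real_inner_mollify (φ : Weight) (f g : L2 ℂ) :
    Tendsto (fun k => ⟪φ.mul (mollify k f), mollify k g⟫_ℝ) atTop (𝓝 ⟪φ.mul f, g⟫_ℝ) :=
  ((φ.mul.continuous.tendsto f).comp (tendsto_mollify f)).inner (tendsto_mollify g)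

theorem real_inner_mollify_left (k : ℕ) (f g : L2 ℂ) :
    ⟪mollify k f, g⟫_ℝ = ⟪f, mollify k g⟫_ℝ := by
  rw [L2.real_inner_eq_re, inner_mollify_left, L2.real_inner_eq_re]

theorem IsWeakDeriv.real_inner_deriv_left {f f' g g' : L2 ℂ} (hf : IsWeakDeriv f f')
    (hg : IsWeakDeriv g g') : ⟪f', g⟫_ℝ = -⟪f, g'⟫_ℝ := by
  rw [L2.real_inner_eq_re, hf.inner_deriv_left hg, L2.real_inner_eq_re, Complex.neg_re]

theorem Weight.HasDeriv.two_mul_real_inner {φ φ' : Weight} (h : φ.HasDeriv φ') {f f' : L2 ℂ}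
    (hf : IsWeakDeriv f f') : 2 * ⟪φ.mul f, f'⟫_ℝ = -⟪φ'.mul f, f⟫_ℝ := by
  have hparts := (h.isWeakDeriv hf).real_inner_deriv_left hf
  rw [inner_add_left, φ.real_inner_mul_left f', ← real_inner_comm f'] at hparts
  linarith

/-! ### Weak evolution equations -/

theorem pos_of_mem_uIcc {s t x : ℝ} (hs : 0 < s) (ht : 0 < t) (hx : x ∈ Set.uIcc s t) : 0 < x :=
  (lt_min hs ht).trans_le hx.1

theorem intervalIntegrable_of_continuousOn_Ioi {E : Type*} [NormedAddCommGroup E] {f : ℝ → E}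
    (hf : ContinuousOn f (Set.Ioi 0)) {s t : ℝ} (hs : 0 < s) (ht : 0 < t) :
    IntervalIntegrable f volume s t :=
  (hf.mono fun _ => pos_of_mem_uIcc hs ht).intervalIntegrable

section

variable {E : Type*} [NormedAddCommGroup E] [NormedSpace ℝ E] [CompleteSpace E]

theorem hasDerivAt_integral_of_continuousOn_Ioi {f : ℝ → E} (hf : ContinuousOn f (Set.Ioi 0))
    {s t : ℝ} (hs : 0 < s) (ht : 0 < t) : HasDerivAt (fun r => ∫ τ in s..r, f τ) (f t) t :=
  intervalIntegral.integral_hasDerivAt_right (intervalIntegrable_of_continuousOn_Ioi hf hs ht)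
    (hf.stronglyMeasurableAtFilter isOpen_Ioi t ht) (hf.continuousAt (Ioi_mem_nhds ht))

theorem hasDerivAt_of_tendsto_of_dominated {F G : ℕ → ℝ → E} {f g : ℝ → E} {B : ℝ → ℝ}
    (hF : ∀ k t, 0 < t → HasDerivAt (F k) (G k t) t)
    (hG : ∀ k, ContinuousOn (G k) (Set.Ioi 0))
    (hFf : ∀ t, 0 < t → Tendsto (fun k => F k t) atTop (𝓝 (f t)))
    (hGg : ∀ t, 0 < t → Tendsto (fun k => G k t) atTop (𝓝 (g t)))
    (hB : ∀ k t, 0 < t → ‖G k t‖ ≤ B t) (hBc : ContinuousOn B (Set.Ioi 0))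
    (hg : ContinuousOn g (Set.Ioi 0)) {t : ℝ} (ht : 0 < t) : HasDerivAt f (g t) t := by
  have heq : ∀ r, 0 < r → f r = f t + ∫ τ in t..r, g τ := by
    intro r hr
    have hpos : ∀ x ∈ Set.uIoc t r, 0 < x := fun x hx =>
      pos_of_mem_uIcc ht hr (Set.uIoc_subset_uIcc hx)
    have hlim : Tendsto (fun k => ∫ τ in t..r, G k τ) atTop (𝓝 (∫ τ in t..r, g τ)) :=
      intervalIntegral.tendsto_integral_filter_of_dominated_convergence B
        (Eventually.of_forall fun k =>
          (intervalIntegrable_of_continuousOn_Ioi (hG k) ht hr).def'.aestronglyMeasurable)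
        (Eventually.of_forall fun k => Eventually.of_forall fun x hx => hB k x (hpos x hx))
        (intervalIntegrable_of_continuousOn_Ioi hBc ht hr)
        (Eventually.of_forall fun x hx => hGg x (hpos x hx))
    have hftc : ∀ k, ∫ τ in t..r, G k τ = F k r - F k t := fun k =>
      intervalIntegral.integral_eq_sub_of_hasDerivAt
        (fun x hx => hF k x (pos_of_mem_uIcc ht hr hx))
        (intervalIntegrable_of_continuousOn_Ioi (hG k) ht hr)
    simp only [hftc] at hlim
    rw [tendsto_nhds_unique hlim ((hFf r hr).sub (hFf t ht)), add_sub_cancel]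
  refine ((hasDerivAt_integral_of_continuousOn_Ioi hg ht ht).const_add
    (f t)).congr_of_eventuallyEq ?_
  filter_upwards [Ioi_mem_nhds ht] with r hr using heq r hr

end

/-- The weak form of `f_t = -D a + b` for `t > 0`, tested against functions in `H¹` and
integrated in time. -/
structure IsWeakEvolution (f a b : ℝ → L2 ℂ) : Prop where
  continuousOn : ContinuousOn f (Set.Ioi 0)
  continuousOn_flux : ContinuousOn a (Set.Ioi 0)
  continuousOn_source : ContinuousOn b (Set.Ioi 0)
  inner_sub_eq : ∀ s t, 0 < s → 0 < t → ∀ η : H1, ⟪H1.toL2 η, f t - f s⟫_ℂ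
    = ⟪H1.weakDeriv η, ∫ τ in s..t, a τ⟫_ℂ + ⟪H1.toL2 η, ∫ τ in s..t, b τ⟫_ℂ

namespace IsWeakEvolution

variable {f a b : ℝ → L2 ℂ} {t : ℝ}

theorem inner_sub_eq_of_hasDerivAt {ζ ζ' : L2 ℂ} (ha : ContinuousOn a (Set.Ioi 0))
    (hb : ContinuousOn b (Set.Ioi 0))
    (h : ∀ t, 0 < t → HasDerivAt (fun s => ⟪ζ, f s⟫_ℂ) (⟪ζ', a t⟫_ℂ + ⟪ζ, b t⟫_ℂ) t)
    {s : ℝ} (hs : 0 < s) (ht : 0 < t) :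
    ⟪ζ, f t - f s⟫_ℂ = ⟪ζ', ∫ τ in s..t, a τ⟫_ℂ + ⟪ζ, ∫ τ in s..t, b τ⟫_ℂ := by
  have hinner (ξ : L2 ℂ) {c : ℝ → L2 ℂ} (hc : ContinuousOn c (Set.Ioi 0)) :
      ContinuousOn (fun τ => ⟪ξ, c τ⟫_ℂ) (Set.Ioi 0) :=
    (innerSL ℂ ξ).continuous.comp_continuousOn hc
  have hint (ξ : L2 ℂ) {c : ℝ → L2 ℂ} (hc : ContinuousOn c (Set.Ioi 0)) :
      ∫ τ in s..t, ⟪ξ, c τ⟫_ℂ = ⟪ξ, ∫ τ in s..t, c τ⟫_ℂ :=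
    ((innerSL ℂ ξ).restrictScalars ℝ).intervalIntegral_comp_comm
      (intervalIntegrable_of_continuousOn_Ioi hc hs ht)
  rw [← hint ζ' ha, ← hint ζ hb, ← intervalIntegral.integral_add
      (intervalIntegrable_of_continuousOn_Ioi (hinner ζ' ha) hs ht)
      (intervalIntegrable_of_continuousOn_Ioi (hinner ζ hb) hs ht),
    intervalIntegral.integral_eq_sub_of_hasDerivAt
      (fun x hx => h x (pos_of_mem_uIcc hs ht hx))
      (intervalIntegrable_of_continuousOn_Ioi ((hinner ζ' ha).add (hinner ζ hb)) hs ht),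
    inner_sub_right]

theorem of_test (hf : ContinuousOn f (Set.Ioi 0))
    (ha : ContinuousOn a (Set.Ioi 0)) (hb : ContinuousOn b (Set.Ioi 0))
    (h : ∀ (η : ℝ → ℝ) (hη : IsTest η), ∀ t, 0 < t →
      HasDerivAt (fun s => ⟪hη.toL2, f s⟫_ℂ) (⟪hη.deriv.toL2, a t⟫_ℂ + ⟪hη.toL2, b t⟫_ℂ) t) :
    IsWeakEvolution f a b where
  continuousOn := hf
  continuousOn_flux := ha
  continuousOn_source := hb
  inner_sub_eq s t hs ht η := by
    simp only [← H1.toL2CLM_apply, ← H1.weakDerivCLM_apply]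
    induction η using H1.test_induction with
    | test η hη => exact inner_sub_eq_of_hasDerivAt ha hb (h η hη) hs ht
    | zero => simp only [map_zero, inner_zero_left, add_zero]
    | add x y hx hy =>
      simp only [map_add, inner_add_left, hx, hy]
      ring
    | smul c x hx => simp only [map_smul, inner_smul_left, hx, mul_add]
    | closed => exact isClosed_eq (by fun_prop) (by fun_prop)

theorem hasDerivAt_clm (h : IsWeakEvolution f a b) {E : Type*} [NormedAddCommGroup E]
    [NormedSpace ℝ E] {A A' : L2 ℂ →L[ℝ] E}
    (hA : ∀ s t, 0 < s → 0 < t →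
      A (f t - f s) = A' (∫ τ in s..t, a τ) + A (∫ τ in s..t, b τ)) (ht : 0 < t) :
    HasDerivAt (fun s => A (f s)) (A' (a t) + A (b t)) t := by
  have hflux := A'.hasFDerivAt.comp_hasDerivAt t
    (hasDerivAt_integral_of_continuousOn_Ioi h.continuousOn_flux ht ht)
  have hsource := A.hasFDerivAt.comp_hasDerivAt t
    (hasDerivAt_integral_of_continuousOn_Ioi h.continuousOn_source ht ht)
  refine ((hflux.add hsource).const_add (A (f t))).congr_of_eventuallyEq ?_
  filter_upwards [Ioi_mem_nhds ht] with r hr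
  rw [← sub_eq_iff_eq_add', ← map_sub, hA t r ht hr]
  rfl

theorem hasDerivAt_real_inner (h : IsWeakEvolution f a b) (η : H1) (ht : 0 < t) :
    HasDerivAt (fun s => ⟪H1.toL2 η, f s⟫_ℝ)
      (⟪H1.weakDeriv η, a t⟫_ℝ + ⟪H1.toL2 η, b t⟫_ℝ) t :=
  h.hasDerivAt_clm (A := innerSL ℝ (H1.toL2 η)) (A' := innerSL ℝ (H1.weakDeriv η))
    (fun s t hs ht => by
      simp only [innerSL_apply_apply, L2.real_inner_eq_re, ← Complex.add_re,
        h.inner_sub_eq s t hs ht η]) ht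

theorem hasDerivAt_mollify (h : IsWeakEvolution f a b) (k : ℕ) (ht : 0 < t) :
    HasDerivAt (fun s => mollify k (f s)) (-mollifyDeriv k (a t) + mollify k (b t)) t :=
  h.hasDerivAt_clm (A := (mollify k).restrictScalars ℝ)
    (A' := (-mollifyDeriv k).restrictScalars ℝ) (fun s t hs ht => by
      refine ext_inner_left ℂ fun g => ?_
      simp only [ContinuousLinearMap.coe_restrictScalars', _root_.neg_apply]
      rw [← inner_mollify_left, inner_add_right, inner_neg_right, ← inner_mollify_left,
        ← inner_mollifyDeriv_left]
      exact h.inner_sub_eq s t hs ht (mollifyH1 k g)) ht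

theorem hasDerivAt_mollifyDeriv (h : IsWeakEvolution f a b) (k : ℕ) (ht : 0 < t) :
    HasDerivAt (fun s => mollifyDeriv k (f s)) (-mollifyDeriv₂ k (a t) + mollifyDeriv k (b t)) t :=
  h.hasDerivAt_clm (A := (mollifyDeriv k).restrictScalars ℝ)
    (A' := (-mollifyDeriv₂ k).restrictScalars ℝ) (fun s t hs ht => by
      refine ext_inner_left ℂ fun g => ?_
      simp only [ContinuousLinearMap.coe_restrictScalars', _root_.neg_apply]
      have := h.inner_sub_eq s t hs ht
        (H1.mk (mollifyDeriv k g) (mollifyDeriv₂ k g) (isWeakDeriv_mollifyDeriv k g))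
      rw [H1.toL2_mk, H1.weakDeriv_mk, inner_mollifyDeriv_left, inner_mollifyDeriv₂_left,
        inner_mollifyDeriv_left] at this
      rw [inner_add_right, inner_neg_right]
      linear_combination -this) ht

theorem hasDerivAt_weight_mollify {σ : ℝ} (h : IsWeakEvolution f (fun t => (σ : ℂ) • f t) b)
    {φ φ' : Weight} (hφ : φ.HasDeriv φ') (k : ℕ) (ht : 0 < t) :
    HasDerivAt (fun s => ⟪φ.mul (mollify k (f s)), mollify k (f s)⟫_ℝ)
      (σ * ⟪φ'.mul (mollify k (f t)), mollify k (f t)⟫_ℝ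
        + 2 * ⟪φ.mul (mollify k (f t)), mollify k (b t)⟫_ℝ) t := by
  have hf := h.hasDerivAt_mollify k ht
  refine (HasDerivAt.inner ℝ ((φ.mul.restrictScalars ℝ).hasFDerivAt.comp_hasDerivAt t hf)
    hf).congr_deriv ?_
  have hparts := hφ.two_mul_real_inner (isWeakDeriv_mollify k (f t))
  simp only [Function.comp_apply, ContinuousLinearMap.coe_restrictScalars']
  rw [φ.real_inner_mul_left (_ + _), real_inner_comm _ (_ + _), inner_add_right, inner_neg_right,
    map_smul, L2.real_inner_eq_re _ ((σ : ℂ) • _), inner_smul_right, Complex.re_ofReal_mul,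
    ← L2.real_inner_eq_re]
  linear_combination (-σ) * hparts

theorem hasDerivAt_weight {σ : ℝ} (h : IsWeakEvolution f (fun t => (σ : ℂ) • f t) b)
    {φ φ' : Weight} (hφ : φ.HasDeriv φ') (ht : 0 < t) :
    HasDerivAt (fun s => ⟪φ.mul (f s), f s⟫_ℝ)
      (σ * ⟪φ'.mul (f t), f t⟫_ℝ + 2 * ⟪φ.mul (f t), b t⟫_ℝ) t := by
  have hcf := h.continuousOn
  have hcb := h.continuousOn_source
  refine hasDerivAt_of_tendsto_of_dominated
    (B := fun s => |σ| * (‖φ'.mul‖ * ‖f s‖ * ‖f s‖) + 2 * (‖φ.mul‖ * ‖f s‖ * ‖b s‖))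
    (g := fun t => σ * ⟪φ'.mul (f t), f t⟫_ℝ + 2 * ⟪φ.mul (f t), b t⟫_ℝ)
    (fun k _ hs => h.hasDerivAt_weight_mollify hφ k hs) (fun k => by fun_prop)
    (fun s _ => φ.tendsto_real_inner_mollify _ _)
    (fun s _ => ((φ'.tendsto_real_inner_mollify _ _).const_mul σ).add
      ((φ.tendsto_real_inner_mollify _ _).const_mul 2))
    (fun k s _ => ?_) (by fun_prop) (by fun_prop) ht
  refine (norm_add_le _ _).trans ?_
  simp only [norm_mul, Real.norm_eq_abs, abs_two]
  gcongr <;> exact Weight.abs_real_inner_mollify_le ..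

end IsWeakEvolution

/-! ### The Schrödinger equation with a real potential -/

theorem L2.ae_im_eq_zero {N : L2 ℂ} (hN : L2.conj N = N) : ∀ᵐ x, (N x).im = 0 := by
  filter_upwards [L2.coeFn_conj N] with x hx
  rw [hN] at hx
  exact Complex.conj_eq_iff_im.1 hx.symm

theorem H1.real_inner_mul_symm {N : L2 ℂ} (hN : L2.conj N = N) (f g : H1) :
    ⟪H1.mul f N, H1.toL2 g⟫_ℝ = ⟪H1.mul g N, H1.toL2 f⟫_ℝ := by
  rw [L2.real_inner_eq_integral, L2.real_inner_eq_integral]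
  refine integral_congr_ae ?_
  filter_upwards [H1.coeFn_mul f N, H1.coeFn_mul g N, L2.ae_im_eq_zero hN] with x hf hg hre
  rw [hf, hg]
  simp only [star_mul', Complex.star_def, Complex.mul_re, Complex.conj_re, Complex.conj_im,
    Complex.mul_im, hre]
  ring

theorem Weight.real_inner_I_smul_mul (φ : Weight) (f : L2 ℂ) :
    ⟪f, Complex.I • φ.mul f⟫_ℝ = 0 := by
  have := L2.real_inner_I_smul_eq_zero_of_symm φ.real_inner_mul_left f
  rwa [φ.real_inner_mul_left, φ.mul.map_smul] at this

theorem Weight.real_inner_I_smul_H1_mul (φ : Weight) {N : L2 ℂ} (hN : L2.conj N = N) (f : H1) :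
    ⟪φ.mul (H1.toL2 f), Complex.I • H1.mul f N⟫_ℝ = 0 := by
  rw [L2.real_inner_eq_integral]
  refine integral_eq_zero_of_ae ?_
  filter_upwards [φ.coeFn_mul (H1.toL2 f), H1.coeFn_mul f N, L2.ae_im_eq_zero hN,
    Lp.coeFn_smul Complex.I (H1.mul f N)] with x hφ hf hre hI
  rw [hI, Pi.smul_apply, hφ, hf]
  simp only [star_mul', Complex.star_def, Complex.mul_re, Complex.conj_re, Complex.conj_im,
    Complex.mul_im, Complex.ofReal_re, Complex.ofReal_im, Complex.I_re, Complex.I_im,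
    smul_eq_mul, hre, Pi.zero_apply]
  ring

/-- `i u_t + u_xx = N u` with a real potential `N`, in the weak form. -/
structure SchrodingerEq (u : ℝ → H1) (N : ℝ → L2 ℂ) : Prop where
  continuousOn : ContinuousOn u (Set.Ioi 0)
  continuousOn_potential : ContinuousOn N (Set.Ioi 0)
  conj_potential : ∀ t, L2.conj (N t) = N t
  isWeakEvolution : IsWeakEvolution (fun t => H1.toL2 (u t))
    (fun t => -Complex.I • H1.weakDeriv (u t)) (fun t => -Complex.I • H1.mul (u t) (N t))

namespace SchrodingerEq

variable {u : ℝ → H1} {N : ℝ → L2 ℂ} {t : ℝ}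

theorem continuousOn_toL2 (h : SchrodingerEq u N) :
    ContinuousOn (fun t => H1.toL2 (u t)) (Set.Ioi 0) :=
  H1.toL2CLM.continuous.comp_continuousOn h.continuousOn

theorem continuousOn_weakDeriv (h : SchrodingerEq u N) :
    ContinuousOn (fun t => H1.weakDeriv (u t)) (Set.Ioi 0) :=
  H1.weakDerivCLM.continuous.comp_continuousOn h.continuousOn

theorem continuousOn_mul (h : SchrodingerEq u N) :
    ContinuousOn (fun t => H1.mul (u t) (N t)) (Set.Ioi 0) :=
  (H1.mul.continuous.comp_continuousOn h.continuousOn).clm_apply h.continuousOn_potential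

theorem hasDerivAt_mollify (h : SchrodingerEq u N) (k : ℕ) (ht : 0 < t) :
    HasDerivAt (fun s => mollify k (H1.toL2 (u s)))
      (Complex.I • (mollifyDeriv₂ k (H1.toL2 (u t)) - mollify k (H1.mul (u t) (N t)))) t := by
  refine (h.isWeakEvolution.hasDerivAt_mollify k ht).congr_deriv ?_
  rw [map_smul, map_smul, ← (H1.isWeakDeriv (u t)).mollifyDeriv₂_eq k, neg_smul, neg_smul,
    neg_neg, smul_sub, sub_eq_add_neg]

theorem hasDerivAt_mollify_weakDeriv (h : SchrodingerEq u N) (k : ℕ) (ht : 0 < t) :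
    HasDerivAt (fun s => mollify k (H1.weakDeriv (u s))) (Complex.I •
      (mollifyDeriv₂ k (H1.weakDeriv (u t)) - mollifyDeriv k (H1.mul (u t) (N t)))) t := by
  simp only [← (H1.isWeakDeriv _).mollifyDeriv_eq k]
  refine (h.isWeakEvolution.hasDerivAt_mollifyDeriv k ht).congr_deriv ?_
  rw [map_smul, map_smul, neg_smul, neg_smul, neg_neg, smul_sub, sub_eq_add_neg]

theorem hasDerivAt_weight_mollify (h : SchrodingerEq u N) {φ φ' : Weight} (hφ : φ.HasDeriv φ')
    (k : ℕ) (ht : 0 < t) :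
    HasDerivAt (fun s => ⟪φ.mul (mollify k (H1.toL2 (u s))), mollify k (H1.toL2 (u s))⟫_ℝ)
      (-2 * ⟪φ'.mul (mollify k (H1.toL2 (u t))),
          mollify k (Complex.I • H1.weakDeriv (u t))⟫_ℝ
        - 2 * ⟪φ.mul (mollify k (H1.toL2 (u t))),
          mollify k (Complex.I • H1.mul (u t) (N t))⟫_ℝ) t := by
  have hu := h.hasDerivAt_mollify k ht
  refine (HasDerivAt.inner ℝ ((φ.mul.restrictScalars ℝ).hasFDerivAt.comp_hasDerivAt t hu)
    hu).congr_deriv ?_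
  have hparts := (hφ.isWeakDeriv (isWeakDeriv_mollify k (H1.toL2 (u t)))).real_inner_deriv_left
    ((isWeakDeriv_mollifyDeriv k (H1.toL2 (u t))).smul Complex.I)
  rw [inner_add_left, φ.real_inner_mul_left (mollifyDeriv k _),
    (H1.isWeakDeriv (u t)).mollifyDeriv_eq k, φ.mul.map_smul, φ.real_inner_I_smul_mul] at hparts
  simp only [Function.comp_apply, ContinuousLinearMap.coe_restrictScalars', map_smul]
  rw [← map_smul φ.mul, φ.real_inner_mul_left (_ • _), real_inner_comm _ (_ • _), smul_sub,
    inner_sub_right]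
  linear_combination 2 * hparts

theorem hasDerivAt_weight (h : SchrodingerEq u N) {φ φ' : Weight} (hφ : φ.HasDeriv φ')
    (ht : 0 < t) :
    HasDerivAt (fun s => ⟪φ.mul (H1.toL2 (u s)), H1.toL2 (u s)⟫_ℝ)
      (-2 * ⟪φ'.mul (H1.toL2 (u t)), Complex.I • H1.weakDeriv (u t)⟫_ℝ) t := by
  have hcu := h.continuousOn_toL2
  have hcu' := h.continuousOn_weakDeriv
  have hcm := h.continuousOn_mul
  refine hasDerivAt_of_tendsto_of_dominated
    (B := fun s => 2 * (‖φ'.mul‖ * ‖H1.toL2 (u s)‖ * ‖Complex.I • H1.weakDeriv (u s)‖)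
      + 2 * (‖φ.mul‖ * ‖H1.toL2 (u s)‖ * ‖Complex.I • H1.mul (u s) (N s)‖))
    (g := fun t => -2 * ⟪φ'.mul (H1.toL2 (u t)), Complex.I • H1.weakDeriv (u t)⟫_ℝ)
    (fun k _ hs => h.hasDerivAt_weight_mollify hφ k hs) (fun k => by fun_prop)
    (fun s _ => φ.tendsto_real_inner_mollify _ _) (fun s _ => ?_) (fun k s _ => ?_)
    (by fun_prop) ?_ ht
  · have hlim := φ.tendsto_real_inner_mollify (H1.toL2 (u s)) (Complex.I • H1.mul (u s) (N s))
    rw [φ.real_inner_I_smul_H1_mul (h.conj_potential s)] at hlim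
    simpa only [mul_zero, sub_zero] using
      ((φ'.tendsto_real_inner_mollify _ _).const_mul (-2)).sub (hlim.const_mul 2)
  · refine (norm_sub_le _ _).trans ?_
    simp only [norm_mul, Real.norm_eq_abs, abs_neg, abs_two]
    gcongr <;> exact Weight.abs_real_inner_mollify_le ..
  · exact continuousOn_const.mul (ContinuousOn.inner (𝕜 := ℝ)
      (φ'.mul.continuous.comp_continuousOn hcu) (hcu'.const_smul Complex.I))

theorem hasDerivAt_momentum_mollify (h : SchrodingerEq u N) {φ φ' φ'' : Weight}
    (hφ : φ.HasDeriv φ') (hφ' : φ'.HasDeriv φ'') (k : ℕ) (ht : 0 < t) :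
    HasDerivAt (fun s => ⟪Complex.I • mollify k (H1.toL2 (u s)),
        φ.mul (mollify k (H1.weakDeriv (u s)))⟫_ℝ)
      (2 * ⟪φ'.mul (mollify k (H1.weakDeriv (u t))), mollify k (H1.weakDeriv (u t))⟫_ℝ
        + ⟪φ''.mul (mollify k (H1.toL2 (u t))), mollify k (H1.weakDeriv (u t))⟫_ℝ
        + 2 * ⟪φ.mul (mollify k (H1.weakDeriv (u t))), mollify k (H1.mul (u t) (N t))⟫_ℝ
        + ⟪φ'.mul (mollify k (H1.toL2 (u t))), mollify k (H1.mul (u t) (N t))⟫_ℝ) t := by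
  refine (HasDerivAt.inner ℝ ((h.hasDerivAt_mollify k ht).const_smul Complex.I)
    ((φ.mul.restrictScalars ℝ).hasFDerivAt.comp_hasDerivAt t
      (h.hasDerivAt_mollify_weakDeriv k ht))).congr_deriv ?_
  simp only [Function.comp_apply, ContinuousLinearMap.coe_restrictScalars', Pi.smul_apply]
  have hu := isWeakDeriv_mollify k (H1.toL2 (u t))
  rw [(H1.isWeakDeriv (u t)).mollifyDeriv_eq k] at hu
  have hu' := isWeakDeriv_mollify k (H1.weakDeriv (u t))
  rw [← (H1.isWeakDeriv (u t)).mollifyDeriv₂_eq k] at hu'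
  have hrhs := (isWeakDeriv_mollifyDeriv k (H1.weakDeriv (u t))).sub
    (isWeakDeriv_mollify k (H1.mul (u t) (N t)))
  rw [← (H1.isWeakDeriv (u t)).mollifyDeriv₂_eq k] at hrhs
  have hflux := (hφ.isWeakDeriv hu).real_inner_deriv_left hrhs
  have hkinetic := hφ.two_mul_real_inner hu'
  have hcross := (hφ'.isWeakDeriv hu).real_inner_deriv_left hu'
  rw [← φ.real_inner_mul_left, φ.mul.map_smul, L2.real_inner_I_smul_left,
    real_inner_comm (φ.mul (mollify k _))]
  simp only [smul_smul, Complex.I_mul_I, neg_one_smul, inner_neg_right, neg_neg]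
  simp only [inner_add_left, inner_sub_right] at hflux hcross ⊢
  linear_combination hflux - hkinetic - hcross

theorem hasDerivAt_momentum (h : SchrodingerEq u N) {φ φ' φ'' : Weight} (hφ : φ.HasDeriv φ')
    (hφ' : φ'.HasDeriv φ'') (ht : 0 < t) :
    HasDerivAt (fun s => ⟪Complex.I • H1.toL2 (u s), φ.mul (H1.weakDeriv (u s))⟫_ℝ)
      (2 * ⟪φ'.mul (H1.weakDeriv (u t)), H1.weakDeriv (u t)⟫_ℝ
        + ⟪φ''.mul (H1.toL2 (u t)), H1.weakDeriv (u t)⟫_ℝ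
        + 2 * ⟪φ.mul (H1.weakDeriv (u t)), H1.mul (u t) (N t)⟫_ℝ
        + ⟪φ'.mul (H1.toL2 (u t)), H1.mul (u t) (N t)⟫_ℝ) t := by
  have hcu := h.continuousOn_toL2
  have hcu' := h.continuousOn_weakDeriv
  have hcm := h.continuousOn_mul
  refine hasDerivAt_of_tendsto_of_dominated
    (B := fun s => 2 * (‖φ'.mul‖ * ‖H1.weakDeriv (u s)‖ * ‖H1.weakDeriv (u s)‖)
      + ‖φ''.mul‖ * ‖H1.toL2 (u s)‖ * ‖H1.weakDeriv (u s)‖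
      + 2 * (‖φ.mul‖ * ‖H1.weakDeriv (u s)‖ * ‖H1.mul (u s) (N s)‖)
      + ‖φ'.mul‖ * ‖H1.toL2 (u s)‖ * ‖H1.mul (u s) (N s)‖)
    (g := fun t => 2 * ⟪φ'.mul (H1.weakDeriv (u t)), H1.weakDeriv (u t)⟫_ℝ
      + ⟪φ''.mul (H1.toL2 (u t)), H1.weakDeriv (u t)⟫_ℝ
      + 2 * ⟪φ.mul (H1.weakDeriv (u t)), H1.mul (u t) (N t)⟫_ℝ
      + ⟪φ'.mul (H1.toL2 (u t)), H1.mul (u t) (N t)⟫_ℝ)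
    (fun k _ hs => h.hasDerivAt_momentum_mollify hφ hφ' k hs) (fun k => by fun_prop)
    (fun s _ => ((tendsto_mollify _).const_smul Complex.I).inner
      ((φ.mul.continuous.tendsto _).comp (tendsto_mollify _)))
    (fun s _ => ((((φ'.tendsto_real_inner_mollify _ _).const_mul 2).add
      (φ''.tendsto_real_inner_mollify _ _)).add
        ((φ.tendsto_real_inner_mollify _ _).const_mul 2)).add
          (φ'.tendsto_real_inner_mollify _ _))
    (fun k s _ => ?_) (by fun_prop) (by fun_prop) ht
  refine (norm_add_le _ _).trans (add_le_add ((norm_add_le _ _).trans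
    (add_le_add ((norm_add_le _ _).trans (add_le_add ?_ ?_)) ?_)) ?_)
  all_goals
    simp only [norm_mul, Real.norm_eq_abs, abs_two]
    first
    | exact Weight.abs_real_inner_mollify_le ..
    | exact mul_le_mul_of_nonneg_left (Weight.abs_real_inner_mollify_le ..) zero_le_two

end SchrodingerEq

/-! ### The density `|f|²` -/

/-- Complex conjugation on `H¹`. -/
noncomputable def H1.conj (f : H1) : H1 :=
  H1.mk (L2.conj (H1.toL2 f)) (L2.conj (H1.weakDeriv f)) (H1.isWeakDeriv f).conj

/-- The density `|f|²`, in `H¹`. -/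
noncomputable def H1.sq (f : H1) : H1 :=
  H1.mk _ _ (H1.isWeakDeriv_mul f (H1.conj f))

theorem H1.toL2_sq (f : H1) : H1.toL2 (H1.sq f) = H1.mul f (L2.conj (H1.toL2 f)) := rfl

/-- The function `2 Re (f̄ g)`, whose diagonal is twice the density `|f|²`. -/
noncomputable def H1.polar (f : H1) (g : L2 ℂ) : L2 ℂ :=
  H1.mul f (L2.conj g) + H1.mul (H1.conj f) g

theorem H1.weakDeriv_sq (f : H1) : H1.weakDeriv (H1.sq f) = H1.polar f (H1.weakDeriv f) := rfl

theorem H1.continuous_conj : Continuous H1.conj :=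
  continuous_iff_continuousAt.2 fun f => H1.tendsto_iff.2
    ⟨(L2.conj.continuous.comp H1.toL2CLM.continuous).tendsto f,
      (L2.conj.continuous.comp H1.weakDerivCLM.continuous).tendsto f⟩

theorem H1.continuous_weakDeriv_sq : Continuous fun f => H1.weakDeriv (H1.sq f) := by
  simp only [H1.weakDeriv_sq, H1.polar]
  exact (H1.mul.continuous.clm_apply (L2.conj.continuous.comp H1.weakDerivCLM.continuous)).add
    ((H1.mul.continuous.comp H1.continuous_conj).clm_apply H1.weakDerivCLM.continuous)

theorem H1.norm_conj (f : H1) : ‖H1.conj f‖ = ‖f‖ := by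
  refine (pow_left_inj₀ (norm_nonneg _) (norm_nonneg _) two_ne_zero).1 ?_
  rw [H1.norm_sq, H1.norm_sq f]
  simp only [H1.conj, H1.toL2_mk, H1.weakDeriv_mk, L2.norm_conj]

theorem H1.norm_polar_le (f : H1) (g : L2 ℂ) : ‖H1.polar f g‖ ≤ 2 * ‖f‖ * ‖g‖ :=
  calc ‖H1.polar f g‖ ≤ ‖f‖ * ‖L2.conj g‖ + ‖H1.conj f‖ * ‖g‖ :=
        (norm_add_le _ _).trans (add_le_add (H1.norm_mul_le _ _) (H1.norm_mul_le _ _))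
    _ = 2 * ‖f‖ * ‖g‖ := by rw [L2.norm_conj, H1.norm_conj]; ring

theorem H1.norm_weakDeriv_sq_le (f : H1) : ‖H1.weakDeriv (H1.sq f)‖ ≤ 2 * ‖f‖ ^ 2 :=
  calc ‖H1.weakDeriv (H1.sq f)‖ ≤ 2 * ‖f‖ * ‖H1.weakDeriv f‖ := H1.norm_polar_le f _
    _ ≤ 2 * ‖f‖ * ‖f‖ := by gcongr; exact H1.norm_weakDeriv_le f
    _ = 2 * ‖f‖ ^ 2 := by ring

theorem H1.coeFn_toL2_sq (f : H1) :
    H1.toL2 (H1.sq f) =ᵐ[volume] fun x => ((‖H1.toL2 f x‖ ^ 2 : ℝ) : ℂ) := by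
  rw [H1.toL2_sq]
  filter_upwards [H1.coeFn_mul f (L2.conj (H1.toL2 f)), L2.coeFn_conj (H1.toL2 f)]
    with x hmul hconj
  rw [hmul, hconj, Complex.star_def, Complex.mul_conj', Complex.ofReal_pow]

theorem H1.coeFn_weakDeriv_sq (f : H1) : H1.weakDeriv (H1.sq f) =ᵐ[volume]
    fun x => ((2 * (star (H1.toL2 f x) * H1.weakDeriv f x).re : ℝ) : ℂ) := by
  rw [H1.weakDeriv_sq, H1.polar]
  filter_upwards [Lp.coeFn_add (H1.mul f (L2.conj (H1.weakDeriv f)))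
      (H1.mul (H1.conj f) (H1.weakDeriv f)), H1.coeFn_mul f (L2.conj (H1.weakDeriv f)),
    L2.coeFn_conj (H1.weakDeriv f), H1.coeFn_mul (H1.conj f) (H1.weakDeriv f),
    L2.coeFn_conj (H1.toL2 f)] with x hadd hmul hderiv hmul' hconj
  replace hconj : H1.toL2 (H1.conj f) x = star (H1.toL2 f x) := hconj
  rw [hadd, Pi.add_apply, hmul, hderiv, hmul', hconj]
  rw [← Complex.add_conj, map_mul, Complex.star_def, Complex.conj_conj]
  ring

theorem H1.real_inner_sq_left {N : L2 ℂ} (hN : L2.conj N = N) (f : H1) :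
    ⟪H1.toL2 (H1.sq f), N⟫_ℝ = ⟪H1.mul f N, H1.toL2 f⟫_ℝ := by
  rw [L2.real_inner_eq_integral, L2.real_inner_eq_integral]
  refine integral_congr_ae ?_
  filter_upwards [H1.coeFn_mul f N, H1.coeFn_toL2_sq f, L2.ae_im_eq_zero hN] with x hmul hsq hre
  rw [hmul, hsq, ← Complex.normSq_eq_norm_sq, Complex.normSq_apply]
  simp only [Complex.star_def, Complex.conj_ofReal, star_mul', Complex.mul_re, Complex.mul_im,
    Complex.conj_re, Complex.conj_im, Complex.ofReal_re, Complex.ofReal_im, hre]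
  ring

theorem Weight.real_inner_weakDeriv_sq (φ : Weight) {N : L2 ℂ} (hN : L2.conj N = N) (f : H1) :
    ⟪φ.mul N, H1.weakDeriv (H1.sq f)⟫_ℝ = 2 * ⟪φ.mul (H1.weakDeriv f), H1.mul f N⟫_ℝ := by
  rw [L2.real_inner_eq_integral, L2.real_inner_eq_integral, ← integral_const_mul]
  refine integral_congr_ae ?_
  filter_upwards [H1.coeFn_mul f N, H1.coeFn_weakDeriv_sq f, L2.ae_im_eq_zero hN, φ.coeFn_mul N,
    φ.coeFn_mul (H1.weakDeriv f)] with x hmul hsq hre hφN hφ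
  rw [hmul, hsq, hφN, hφ]
  simp only [Complex.star_def, star_mul', Complex.conj_ofReal, Complex.mul_re, Complex.mul_im,
    Complex.conj_re, Complex.conj_im, Complex.ofReal_re, Complex.ofReal_im, hre]
  ring

/-! ### The Zakharov system -/

namespace IsWeakEvolution

variable {f a b f' a' b' : ℝ → L2 ℂ}

protected theorem add (h : IsWeakEvolution f a b) (h' : IsWeakEvolution f' a' b') :
    IsWeakEvolution (fun t => f t + f' t) (fun t => a t + a' t) (fun t => b t + b' t) where
  continuousOn := h.continuousOn.add h'.continuousOn
  continuousOn_flux := h.continuousOn_flux.add h'.continuousOn_flux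
  continuousOn_source := h.continuousOn_source.add h'.continuousOn_source
  inner_sub_eq s t hs ht η := by
    rw [intervalIntegral.integral_add
        (intervalIntegrable_of_continuousOn_Ioi h.continuousOn_flux hs ht)
        (intervalIntegrable_of_continuousOn_Ioi h'.continuousOn_flux hs ht),
      intervalIntegral.integral_add
        (intervalIntegrable_of_continuousOn_Ioi h.continuousOn_source hs ht)
        (intervalIntegrable_of_continuousOn_Ioi h'.continuousOn_source hs ht),
      add_sub_add_comm, inner_add_right, h.inner_sub_eq s t hs ht η,
      h'.inner_sub_eq s t hs ht η, inner_add_right, inner_add_right]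
    ring

protected theorem neg (h : IsWeakEvolution f a b) :
    IsWeakEvolution (fun t => -f t) (fun t => -a t) (fun t => -b t) where
  continuousOn := h.continuousOn.neg
  continuousOn_flux := h.continuousOn_flux.neg
  continuousOn_source := h.continuousOn_source.neg
  inner_sub_eq s t hs ht η := by
    rw [intervalIntegral.integral_neg, intervalIntegral.integral_neg, ← neg_sub', inner_neg_right,
      h.inner_sub_eq s t hs ht η, inner_neg_right, inner_neg_right, neg_add]

end IsWeakEvolution

/-- The Zakharov system in weak form, with the real densities `n` and `v` regarded as elements
`N` and `V` of the complex space `L²`. -/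
structure System (u : ℝ → H1) (N V : ℝ → L2 ℂ) : Prop where
  schrodinger : SchrodingerEq u N
  density : IsWeakEvolution N V (fun _ => 0)
  velocity : IsWeakEvolution V N (fun t => -H1.weakDeriv (H1.sq (u t)))

theorem Weight.real_inner_mul_comm (φ : Weight) (f g : L2 ℂ) :
    ⟪φ.mul f, g⟫_ℝ = ⟪φ.mul g, f⟫_ℝ := by
  rw [φ.real_inner_mul_left, real_inner_comm]

namespace System

variable {u : ℝ → H1} {N V : ℝ → L2 ℂ} {φ φ' : Weight} {t : ℝ}

-- `N + V` and `N - V` are the Riemann invariants of the wave part: they are transported to the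
-- right and to the left with unit speed.
theorem hasDerivAt_weight_add (h : System u N V) (hφ : φ.HasDeriv φ') (ht : 0 < t) :
    HasDerivAt (fun s => ⟪φ.mul (N s + V s), N s + V s⟫_ℝ)
      (⟪φ'.mul (N t + V t), N t + V t⟫_ℝ
        - 2 * ⟪φ.mul (N t + V t), H1.weakDeriv (H1.sq (u t))⟫_ℝ) t := by
  have hadd : IsWeakEvolution (fun t => N t + V t) (fun t => ((1 : ℝ) : ℂ) • (N t + V t))
      (fun t => -H1.weakDeriv (H1.sq (u t))) := by
    simpa only [zero_add, Complex.ofReal_one, one_smul, add_comm (V _)] using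
      h.density.add h.velocity
  refine (hadd.hasDerivAt_weight hφ ht).congr_deriv ?_
  rw [inner_neg_right]
  ring

theorem hasDerivAt_weight_sub (h : System u N V) (hφ : φ.HasDeriv φ') (ht : 0 < t) :
    HasDerivAt (fun s => ⟪φ.mul (N s - V s), N s - V s⟫_ℝ)
      (-⟪φ'.mul (N t - V t), N t - V t⟫_ℝ
        + 2 * ⟪φ.mul (N t - V t), H1.weakDeriv (H1.sq (u t))⟫_ℝ) t := by
  have hsub : IsWeakEvolution (fun t => N t - V t) (fun t => ((-1 : ℝ) : ℂ) • (N t - V t))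
      (fun t => H1.weakDeriv (H1.sq (u t))) := by
    simpa only [zero_add, neg_neg, Complex.ofReal_neg, Complex.ofReal_one, neg_one_smul,
      neg_sub, ← sub_eq_add_neg] using h.density.add h.velocity.neg
  refine (hsub.hasDerivAt_weight hφ ht).congr_deriv ?_
  ring

theorem hasDerivAt_waveEnergy (h : System u N V) (hφ : φ.HasDeriv φ') (ht : 0 < t) :
    HasDerivAt (fun s => ⟪φ.mul (N s), N s⟫_ℝ + ⟪φ.mul (V s), V s⟫_ℝ)
      (2 * ⟪φ'.mul (N t), V t⟫_ℝ - 2 * ⟪φ.mul (V t), H1.weakDeriv (H1.sq (u t))⟫_ℝ) t := by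
  refine ((((h.hasDerivAt_weight_add hφ ht).add (h.hasDerivAt_weight_sub hφ ht)).const_mul
    (1 / 2 : ℝ)).congr_deriv ?_).congr_of_eventuallyEq (Eventually.of_forall fun s => ?_)
  · simp only [map_add, map_sub, inner_add_left, inner_add_right, inner_sub_left, inner_sub_right]
    rw [φ'.real_inner_mul_comm (V t) (N t)]
    ring
  · simp only [Pi.add_apply, map_add, map_sub, inner_add_left, inner_add_right, inner_sub_left,
      inner_sub_right]
    ring

theorem hasDerivAt_waveMomentum (h : System u N V) (hφ : φ.HasDeriv φ') (ht : 0 < t) :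
    HasDerivAt (fun s => ⟪φ.mul (N s), V s⟫_ℝ)
      ((⟪φ'.mul (N t), N t⟫_ℝ + ⟪φ'.mul (V t), V t⟫_ℝ) / 2
        - ⟪φ.mul (N t), H1.weakDeriv (H1.sq (u t))⟫_ℝ) t := by
  refine ((((h.hasDerivAt_weight_add hφ ht).sub (h.hasDerivAt_weight_sub hφ ht)).const_mul
    (1 / 4 : ℝ)).congr_deriv ?_).congr_of_eventuallyEq (Eventually.of_forall fun s => ?_)
  · simp only [map_add, map_sub, inner_add_left, inner_add_right, inner_sub_left, inner_sub_right]
    ring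
  · simp only [Pi.sub_apply, map_add, map_sub, inner_add_left, inner_add_right, inner_sub_left,
      inner_sub_right]
    rw [φ.real_inner_mul_comm (V s) (N s)]
    ring

end System

/-! ### Conservation of energy -/

namespace Weight

/-- The constant weight `1`. -/
protected noncomputable def one : Weight := ⟨fun _ => 1, measurable_const, 1, by simp⟩

/-- The weight `0`, the derivative of the constant weight. -/
protected noncomputable def zero : Weight := ⟨fun _ => 0, measurable_const, 1, by simp⟩

theorem hasDeriv_one : Weight.one.HasDeriv Weight.zero :=
  IsPrimitive.of_hasDerivAt
    (fun x => by simpa [Weight.one, Weight.zero] using hasDerivAt_const x (1 : ℂ))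
    (by simpa [Weight.zero] using continuous_const)

protected theorem one_mul (f : L2 ℂ) : Weight.one.mul f = f := by
  refine Lp.ext ?_
  filter_upwards [Weight.one.coeFn_mul f] with x hx
  rw [hx, Weight.one, Complex.ofReal_one, _root_.one_mul]

protected theorem zero_mul (f : L2 ℂ) : Weight.zero.mul f = 0 := by
  refine Lp.ext ?_
  filter_upwards [Weight.zero.coeFn_mul f, Lp.coeFn_zero ℂ 2 (volume : Measure ℝ)] with x hx h0
  rw [hx, h0, Weight.zero, Complex.ofReal_zero, MulZeroClass.zero_mul, Pi.zero_apply]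

end Weight

theorem hasDerivAt_real_inner_sub {X Y : ℝ → L2 ℂ} {Y' : L2 ℂ} {t : ℝ} (hX : ContinuousAt X t)
    (hY : HasDerivAt Y Y' t) : HasDerivAt (fun s => ⟪X s, Y s - Y t⟫_ℝ) ⟪X t, Y'⟫_ℝ t := by
  rw [hasDerivAt_iff_tendsto_slope] at hY ⊢
  refine (Tendsto.inner (𝕜 := ℝ) (hX.tendsto.mono_left nhdsWithin_le_nhds) hY).congr fun s => ?_
  simp only [slope, vsub_eq_sub, sub_self, inner_zero_right, sub_zero, smul_eq_mul,
    real_inner_smul_right]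

theorem real_inner_I_smul_mollify_self (k : ℕ) (f : L2 ℂ) :
    ⟪f, Complex.I • mollify k f⟫_ℝ = 0 := by
  have := L2.real_inner_I_smul_eq_zero_of_symm (real_inner_mollify_left k) f
  rwa [real_inner_mollify_left, (mollify k).map_smul] at this

theorem real_inner_I_smul_mollifyDeriv₂ (k : ℕ) (f g : L2 ℂ) :
    ⟪g, Complex.I • mollifyDeriv₂ k f⟫_ℝ
      = freq k ^ 2 * (⟪g, Complex.I • mollify k f⟫_ℝ - ⟪g, Complex.I • f⟫_ℝ) := by
  rw [mollifyDeriv₂_apply, smul_comm, L2.real_inner_eq_re, inner_smul_right,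
    Complex.re_ofReal_mul, ← L2.real_inner_eq_re, smul_sub, inner_sub_right]

theorem H1.real_inner_mollify_weakDeriv_self (k : ℕ) (f : H1) :
    ⟪mollify k (H1.weakDeriv f), H1.weakDeriv f⟫_ℝ
      = freq k ^ 2 * (‖H1.toL2 f‖ ^ 2 - ⟪mollify k (H1.toL2 f), H1.toL2 f⟫_ℝ) := by
  have hparts := (isWeakDeriv_mollifyDeriv k (H1.toL2 f)).real_inner_deriv_left (H1.isWeakDeriv f)
  rw [(H1.isWeakDeriv f).mollifyDeriv_eq k, mollifyDeriv₂_apply, L2.real_inner_eq_re,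
    inner_smul_left, Complex.conj_ofReal, Complex.re_ofReal_mul, ← L2.real_inner_eq_re,
    inner_sub_left, real_inner_self_eq_norm_sq] at hparts
  linarith

theorem H1.real_inner_mul_I_smul_self {N : L2 ℂ} (hN : L2.conj N = N) (f : H1) :
    ⟪H1.mul f N, Complex.I • H1.toL2 f⟫_ℝ = 0 := by
  have hsymm := H1.real_inner_mul_symm hN f (Complex.I • f)
  rw [show H1.toL2 (Complex.I • f) = Complex.I • H1.toL2 f from rfl, map_smul,
    _root_.smul_apply, L2.real_inner_I_smul_left] at hsymm
  linarith

theorem H1.real_inner_mul_I_smul {N : L2 ℂ} (hN : L2.conj N = N) (f g : H1) :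
    ⟪H1.mul f N, Complex.I • H1.toL2 g⟫_ℝ = ⟪H1.toL2 f, Complex.I • H1.mul g N⟫_ℝ := by
  have hsymm := H1.real_inner_mul_symm hN f (Complex.I • g)
  rwa [show H1.toL2 (Complex.I • g) = Complex.I • H1.toL2 g from rfl, map_smul,
    _root_.smul_apply, real_inner_comm (H1.toL2 f)] at hsymm

namespace SchrodingerEq

variable {u : ℝ → H1} {N : ℝ → L2 ℂ} {t : ℝ}

theorem hasDerivAt_norm_sq (h : SchrodingerEq u N) (ht : 0 < t) :
    HasDerivAt (fun s => ‖H1.toL2 (u s)‖ ^ 2) 0 t := by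
  simpa only [Weight.one_mul, Weight.zero_mul, inner_zero_left, mul_zero,
    real_inner_self_eq_norm_sq] using h.hasDerivAt_weight Weight.hasDeriv_one ht

theorem continuousAt_toL2 (h : SchrodingerEq u N) (ht : 0 < t) :
    ContinuousAt (fun s => H1.toL2 (u s)) t :=
  h.continuousOn_toL2.continuousAt (Ioi_mem_nhds ht)

theorem hasDerivAt_real_inner_mollify_self (h : SchrodingerEq u N) (k : ℕ) (ht : 0 < t) :
    HasDerivAt (fun s => ⟪mollify k (H1.toL2 (u s)), H1.toL2 (u s)⟫_ℝ)
      (-2 * ⟪mollify k (H1.toL2 (u t)), Complex.I • H1.mul (u t) (N t)⟫_ℝ) t := by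
  have hsum : ContinuousAt (fun s => H1.toL2 (u s) + H1.toL2 (u t)) t :=
    (h.continuousAt_toL2 ht).add continuousAt_const
  have hderiv := (hasDerivAt_real_inner_sub hsum (h.hasDerivAt_mollify k ht)).const_add
      ⟪mollify k (H1.toL2 (u t)), H1.toL2 (u t)⟫_ℝ
  refine (hderiv.congr_deriv ?_).congr_of_eventuallyEq (Eventually.of_forall fun s => ?_)
  · rw [smul_sub, inner_sub_right, inner_add_left, inner_add_left,
      real_inner_I_smul_mollifyDeriv₂, real_inner_I_smul_mollify_self,
      L2.real_inner_I_smul_self, ← (mollify k).map_smul, ← real_inner_mollify_left]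
    ring
  · have hsymm := real_inner_mollify_left k (H1.toL2 (u s)) (H1.toL2 (u t))
    simp only [inner_add_left, inner_sub_right]
    rw [real_inner_comm (mollify k (H1.toL2 (u s))), ← hsymm,
      real_inner_comm (mollify k (H1.toL2 (u s))) (H1.toL2 (u t)),
      real_inner_comm (mollify k (H1.toL2 (u t))) (H1.toL2 (u t))]
    ring

theorem hasDerivAt_mollified_kinetic (h : SchrodingerEq u N) (k : ℕ) (ht : 0 < t) :
    HasDerivAt (fun s => ⟪mollify k (H1.weakDeriv (u s)), H1.weakDeriv (u s)⟫_ℝ)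
      (2 * freq k ^ 2 * ⟪mollify k (H1.toL2 (u t)), Complex.I • H1.mul (u t) (N t)⟫_ℝ) t := by
  simp only [H1.real_inner_mollify_weakDeriv_self]
  refine (((h.hasDerivAt_norm_sq ht).sub
    (h.hasDerivAt_real_inner_mollify_self k ht)).const_mul (freq k ^ 2)).congr_deriv ?_
  ring

end SchrodingerEq

namespace System

variable {u : ℝ → H1} {N V : ℝ → L2 ℂ} {t : ℝ}

/-- The energy of the Zakharov system. -/
noncomputable def energy (u : ℝ → H1) (N V : ℝ → L2 ℂ) (t : ℝ) : ℝ :=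
  ‖H1.weakDeriv (u t)‖ ^ 2 + ⟪H1.mul (u t) (N t), H1.toL2 (u t)⟫_ℝ + (‖N t‖ ^ 2 + ‖V t‖ ^ 2) / 2

/-- The energy with the Schrödinger component mollified, which is differentiable in time without
further regularity. -/
noncomputable def mollifiedEnergy (u : ℝ → H1) (N V : ℝ → L2 ℂ) (k : ℕ) (t : ℝ) : ℝ :=
  ⟪mollify k (H1.weakDeriv (u t)), H1.weakDeriv (u t)⟫_ℝ
    + ⟪H1.mul (mollifyH1 k (H1.toL2 (u t))) (N t), mollify k (H1.toL2 (u t))⟫_ℝ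
    + (‖N t‖ ^ 2 + ‖V t‖ ^ 2) / 2

/-- The time derivative of the mollified energy. -/
noncomputable def mollifiedEnergyRate (u : ℝ → H1) (N V : ℝ → L2 ℂ) (k : ℕ) (t : ℝ) : ℝ :=
  -2 * ⟪H1.mul (mollifyH1 k (H1.toL2 (u t))) (N t),
      Complex.I • mollify k (H1.mul (u t) (N t))⟫_ℝ
    + ⟪H1.weakDeriv (H1.sq (mollifyH1 k (H1.toL2 (u t)))), V t⟫_ℝ
    - ⟪V t, H1.weakDeriv (H1.sq (u t))⟫_ℝ

theorem tendsto_mul_mollifyH1 (u : ℝ → H1) (N : ℝ → L2 ℂ) (t : ℝ) :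
    Tendsto (fun k => H1.mul (mollifyH1 k (H1.toL2 (u t))) (N t)) atTop
      (𝓝 (H1.mul (u t) (N t))) :=
  ((H1.mul.flip (N t)).continuous.tendsto (u t)).comp (tendsto_mollifyH1 (u t))

theorem tendsto_mollifiedEnergy (t : ℝ) :
    Tendsto (fun k => mollifiedEnergy u N V k t) atTop (𝓝 (energy u N V t)) := by
  rw [energy, ← real_inner_self_eq_norm_sq (H1.weakDeriv (u t))]
  exact (((tendsto_mollify _).inner tendsto_const_nhds).add
    ((tendsto_mul_mollifyH1 u N t).inner (tendsto_mollify _))).add tendsto_const_nhds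

theorem hasDerivAt_wave_norm_sq (h : System u N V) (ht : 0 < t) :
    HasDerivAt (fun s => ‖N s‖ ^ 2 + ‖V s‖ ^ 2)
      (-2 * ⟪V t, H1.weakDeriv (H1.sq (u t))⟫_ℝ) t := by
  simpa only [Weight.one_mul, Weight.zero_mul, inner_zero_left, mul_zero, zero_sub, neg_mul,
    real_inner_self_eq_norm_sq] using h.hasDerivAt_waveEnergy Weight.hasDeriv_one ht

theorem hasDerivAt_mollified_interaction (h : System u N V) (k : ℕ) (ht : 0 < t) :
    HasDerivAt
      (fun s => ⟪H1.mul (mollifyH1 k (H1.toL2 (u s))) (N s), mollify k (H1.toL2 (u s))⟫_ℝ)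
      (-2 * freq k ^ 2 * ⟪mollify k (H1.toL2 (u t)), Complex.I • H1.mul (u t) (N t)⟫_ℝ
        - 2 * ⟪H1.mul (mollifyH1 k (H1.toL2 (u t))) (N t),
          Complex.I • mollify k (H1.mul (u t) (N t))⟫_ℝ
        + ⟪H1.weakDeriv (H1.sq (mollifyH1 k (H1.toL2 (u t)))), V t⟫_ℝ) t := by
  have hs := h.schrodinger
  set w : ℝ → H1 := fun s => mollifyH1 k (H1.toL2 (u s))
  have hcw : ContinuousAt w t :=
    (continuous_mollifyH1 k).continuousAt.comp (hs.continuousAt_toL2 ht)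
  have hcmul : ContinuousAt (fun s => H1.mul (w s + w t) (N s)) t :=
    (H1.mul.continuous.continuousAt.comp (hcw.add continuousAt_const)).clm_apply
      (hs.continuousOn_potential.continuousAt (Ioi_mem_nhds ht))
  refine (((hasDerivAt_real_inner_sub hcmul (hs.hasDerivAt_mollify k ht)).add
    (h.density.hasDerivAt_real_inner (H1.sq (w t)) ht)).congr_deriv ?_).congr_of_eventuallyEq
      (Eventually.of_forall fun s => ?_)
  · have hself : ⟪H1.mul (w t) (N t), Complex.I • mollify k (H1.toL2 (u t))⟫_ℝ = 0 :=
      H1.real_inner_mul_I_smul_self (hs.conj_potential t) (w t)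
    have hcross := H1.real_inner_mul_I_smul (hs.conj_potential t) (w t) (u t)
    rw [smul_sub, inner_sub_right, map_add, _root_.add_apply, inner_add_left, inner_add_left,
      real_inner_I_smul_mollifyDeriv₂, hself, hcross, inner_zero_right]
    change _ = -2 * freq k ^ 2 * ⟪H1.toL2 (w t), _⟫_ℝ - _ + _
    ring
  · have hsymm := H1.real_inner_mul_symm (hs.conj_potential s) (w s) (w t)
    change ⟪H1.mul (w s) (N s), H1.toL2 (w s)⟫_ℝ
      = ⟪H1.mul (w s + w t) (N s), H1.toL2 (w s) - H1.toL2 (w t)⟫_ℝ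
        + ⟪H1.toL2 (H1.sq (w t)), N s⟫_ℝ
    rw [H1.real_inner_sq_left (hs.conj_potential s), map_add, _root_.add_apply, inner_add_left,
      inner_sub_right, inner_sub_right, hsymm]
    ring

theorem hasDerivAt_mollifiedEnergy (h : System u N V) (k : ℕ) (ht : 0 < t) :
    HasDerivAt (mollifiedEnergy u N V k) (mollifiedEnergyRate u N V k t) t := by
  rw [mollifiedEnergyRate]
  refine (((h.schrodinger.hasDerivAt_mollified_kinetic k ht).add
    (h.hasDerivAt_mollified_interaction k ht)).add
      ((h.hasDerivAt_wave_norm_sq ht).div_const 2)).congr_deriv ?_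
  ring

theorem tendsto_mollifiedEnergyRate (u : ℝ → H1) (N V : ℝ → L2 ℂ) (t : ℝ) :
    Tendsto (fun k => mollifiedEnergyRate u N V k t) atTop (𝓝 0) := by
  simp only [mollifiedEnergyRate]
  have hmul : Tendsto (fun k => ⟪H1.mul (mollifyH1 k (H1.toL2 (u t))) (N t),
      Complex.I • mollify k (H1.mul (u t) (N t))⟫_ℝ) atTop (𝓝 0) := by
    rw [← L2.real_inner_I_smul_self (H1.mul (u t) (N t))]
    exact (tendsto_mul_mollifyH1 u N t).inner ((tendsto_mollify _).const_smul Complex.I)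
  have hsq : Tendsto (fun k => ⟪H1.weakDeriv (H1.sq (mollifyH1 k (H1.toL2 (u t)))), V t⟫_ℝ) atTop
      (𝓝 ⟪V t, H1.weakDeriv (H1.sq (u t))⟫_ℝ) := by
    rw [real_inner_comm]
    exact ((H1.continuous_weakDeriv_sq.tendsto _).comp (tendsto_mollifyH1 _)).inner
      tendsto_const_nhds
  simpa only [mul_zero, zero_add, sub_self] using ((hmul.const_mul (-2)).add hsq).sub_const
    ⟪V t, H1.weakDeriv (H1.sq (u t))⟫_ℝ

theorem abs_mollifiedEnergyRate_le (u : ℝ → H1) (N V : ℝ → L2 ℂ) (k : ℕ) (t : ℝ) :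
    |mollifiedEnergyRate u N V k t|
      ≤ 2 * (‖u t‖ * ‖N t‖ * (‖u t‖ * ‖N t‖)) + 2 * ‖u t‖ ^ 2 * ‖V t‖
        + ‖V t‖ * (2 * ‖u t‖ ^ 2) := by
  have hw := norm_mollifyH1_le k (u t)
  have hmul : ‖H1.mul (mollifyH1 k (H1.toL2 (u t))) (N t)‖ ≤ ‖u t‖ * ‖N t‖ :=
    (H1.norm_mul_le _ _).trans (mul_le_mul_of_nonneg_right hw (norm_nonneg _))
  have hI : ‖Complex.I • mollify k (H1.mul (u t) (N t))‖ ≤ ‖u t‖ * ‖N t‖ := by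
    rw [norm_smul, Complex.norm_I, one_mul]
    exact (norm_mollify_le k _).trans (H1.norm_mul_le _ _)
  have hsq : ‖H1.weakDeriv (H1.sq (mollifyH1 k (H1.toL2 (u t))))‖ ≤ 2 * ‖u t‖ ^ 2 :=
    (H1.norm_weakDeriv_sq_le _).trans (by gcongr)
  refine (abs_sub _ _).trans (add_le_add ((abs_add_le _ _).trans (add_le_add ?_ ?_)) ?_)
  · rw [abs_mul, abs_neg, abs_two]
    gcongr
    exact (abs_real_inner_le_norm _ _).trans (by gcongr)
  · exact (abs_real_inner_le_norm _ _).trans (by gcongr)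
  · exact (abs_real_inner_le_norm _ _).trans (by gcongr; exact H1.norm_weakDeriv_sq_le _)

theorem hasDerivAt_energy (h : System u N V) (ht : 0 < t) : HasDerivAt (energy u N V) 0 t := by
  have hcu := h.schrodinger.continuousOn
  have hcN := h.density.continuousOn
  have hcV := h.velocity.continuousOn
  have hcm := h.schrodinger.continuousOn_mul
  have hcw (k : ℕ) : ContinuousOn (fun s => mollifyH1 k (H1.toL2 (u s))) (Set.Ioi 0) :=
    (continuous_mollifyH1 k).comp_continuousOn h.schrodinger.continuousOn_toL2
  refine hasDerivAt_of_tendsto_of_dominated (g := fun _ => 0)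
    (fun k s hs => h.hasDerivAt_mollifiedEnergy k hs) (fun k => ?_)
    (fun s _ => tendsto_mollifiedEnergy s) (fun s _ => tendsto_mollifiedEnergyRate u N V s)
    (fun k s _ => abs_mollifiedEnergyRate_le u N V k s) (by fun_prop) continuousOn_const ht
  have hcwN := (H1.mul.continuous.comp_continuousOn (hcw k)).clm_apply hcN
  have hcI := ((mollify k).continuous.comp_continuousOn hcm).const_smul Complex.I
  exact ((continuousOn_const.mul (hcwN.inner (𝕜 := ℝ) hcI)).add
    ((H1.continuous_weakDeriv_sq.comp_continuousOn (hcw k)).inner (𝕜 := ℝ) hcV)).sub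
      (hcV.inner (𝕜 := ℝ) (H1.continuous_weakDeriv_sq.comp_continuousOn hcu))

end System

/-! ### Exponential weights -/

theorem ae_sign_mul_sign : ∀ᵐ x : ℝ, ((SignType.sign x : ℝ) : ℂ) * (SignType.sign x : ℝ) = 1 := by
  filter_upwards [compl_mem_ae_iff.2 (measure_singleton (0 : ℝ))] with x hx
  exact_mod_cast sign_mul_sign hx

theorem exp_neg_mul_abs_le_one (a : ℝ≥0) (x : ℝ) : Real.exp (-a * |x|) ≤ 1 :=
  Real.exp_le_one_iff.2 (by rw [neg_mul]; exact neg_nonpos.2 (by positivity))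

theorem IsPrimitive.const_mul_sub {F f : ℝ → ℂ} (h : IsPrimitive F f) (c : ℂ) :
    IsPrimitive (fun x => c * (F x - F 0)) (fun x => c * f x) where
  locallyIntegrable := h.locallyIntegrable.continuous_mul continuous_const
  eq_add x := by
    rw [intervalIntegral.integral_const_mul, ← h.sub_eq_integral]
    ring

namespace Weight

theorem locallyIntegrable (φ : Weight) : LocallyIntegrable fun x => (φ x : ℂ) :=
  φ.memLp.locallyIntegrable le_top

/-- The sign, as a weight. -/
noncomputable def sgn : Weight := ⟨fun x => SignType.sign x, measurable_sign, 1, abs_sign_le_one⟩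

/-- The weight `exp (-a |x|)`. -/
noncomputable def expAbs (a : ℝ≥0) : Weight :=
  ⟨fun x => Real.exp (-a * |x|), by fun_prop, 1, fun x => by
    simpa only [Real.abs_exp] using exp_neg_mul_abs_le_one a x⟩

/-- The derivative of the weight `exp (-a |x|)`. -/
noncomputable def expAbsDeriv (a : ℝ≥0) : Weight :=
  ⟨fun x => -a * (SignType.sign x * Real.exp (-a * |x|)),
    measurable_const.mul (measurable_sign.mul (by fun_prop)), a, fun x => by
      rw [abs_mul, abs_neg, NNReal.abs_eq, abs_mul, Real.abs_exp]
      exact mul_le_of_le_one_right a.2 (mul_le_one₀ (abs_sign_le_one x) (Real.exp_pos _).le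
        (exp_neg_mul_abs_le_one a x))⟩

theorem hasDeriv_expAbs (a : ℝ≥0) : (expAbs a).HasDeriv (expAbsDeriv a) := by
  refine ⟨(expAbsDeriv a).locallyIntegrable, fun x => ?_⟩
  have hint : IntervalIntegrable (fun x => (expAbsDeriv a x : ℂ)) volume 0 x :=
    (IsPrimitive.integral (expAbsDeriv a).locallyIntegrable).intervalIntegrable 0 x
  have hcont : Continuous fun x => (expAbs a x : ℂ) := by
    simp only [expAbs]
    fun_prop
  rw [MeasureTheory.integral_eq_of_hasDerivAt_off_countable _ _ (Set.countable_singleton (0 : ℝ))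
    hcont.continuousOn ?_ hint, add_sub_cancel]
  rintro y ⟨-, hy⟩
  refine (((hasDerivAt_abs hy).const_mul (-(a : ℝ))).exp.congr_deriv ?_).ofReal_comp
  simp only [expAbsDeriv]
  ring

/-- The bounded primitive `∫₀ˣ exp (-2 |y|) dy`. -/
noncomputable def expAbsPrimitive : Weight :=
  ⟨fun x => SignType.sign x * (1 / 2 * (1 - Real.exp (-(2 : ℝ≥0) * |x|))),
    measurable_sign.mul (by fun_prop), 1, fun x => by
      have hle := exp_neg_mul_abs_le_one 2 x
      have hpos := Real.exp_pos (-(2 : ℝ≥0) * |x|)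
      rw [abs_mul]
      exact mul_le_one₀ (abs_sign_le_one x) (abs_nonneg _)
        (abs_le.2 ⟨by linarith, by linarith⟩)⟩

theorem hasDeriv_expAbsPrimitive : expAbsPrimitive.HasDeriv (expAbs 2) := by
  have hprim := ((hasDeriv_expAbs 2).const_mul_sub (-(1 / 2))).sign_mul (by rw [sub_self, mul_zero])
  have hfun : (fun x => (expAbsPrimitive x : ℂ)) = fun x : ℝ => ((SignType.sign x : ℝ) : ℂ) *
      (-(1 / 2) * ((expAbs 2 x : ℂ) - (expAbs 2 0 : ℂ))) := by
    funext x
    simp only [expAbsPrimitive, expAbs, abs_zero, mul_zero, Real.exp_zero]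
    push_cast
    ring
  rw [HasDeriv, hfun]
  refine hprim.congr ?_
  filter_upwards [ae_sign_mul_sign] with x hx
  simp only [expAbsDeriv, expAbs]
  push_cast at hx ⊢
  linear_combination Complex.exp (-2 * (|x| : ℝ)) * hx

theorem expAbs_mul_expAbs (a b : ℝ≥0) (f : L2 ℂ) :
    (expAbs a).mul ((expAbs b).mul f) = (expAbs (a + b)).mul f := by
  refine Weight.mul_mul _ _ _ (fun x => ?_) f
  simp only [expAbs]
  rw [← Real.exp_add, NNReal.coe_add]
  ring_nf

theorem expAbsDeriv_mul (a : ℝ≥0) (f : L2 ℂ) :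
    (expAbsDeriv a).mul f = -((a : ℝ) • sgn.mul ((expAbs a).mul f)) := by
  refine Lp.ext ?_
  filter_upwards [(expAbsDeriv a).coeFn_mul f, sgn.coeFn_mul ((expAbs a).mul f),
    (expAbs a).coeFn_mul f, Lp.coeFn_neg ((a : ℝ) • sgn.mul ((expAbs a).mul f)),
    Lp.coeFn_smul (a : ℝ) (sgn.mul ((expAbs a).mul f))] with x hderiv hsgn hexp hneg hsmul
  rw [hderiv, hneg, Pi.neg_apply, hsmul, Pi.smul_apply, hsgn, hexp]
  simp only [expAbsDeriv, expAbs, sgn, Complex.real_smul]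
  push_cast
  ring

theorem sgn_mul_sgn_mul (f : L2 ℂ) : sgn.mul (sgn.mul f) = f := by
  refine Lp.ext ?_
  filter_upwards [sgn.coeFn_mul (sgn.mul f), sgn.coeFn_mul f, ae_sign_mul_sign]
    with x houter hinner hsign
  rw [houter, hinner, ← mul_assoc]
  exact (congrArg (· * f x) hsign).trans (_root_.one_mul _)

theorem norm_sgn_mul (f : L2 ℂ) : ‖sgn.mul f‖ = ‖f‖ := by
  have hle (g : L2 ℂ) : ‖sgn.mul g‖ ≤ ‖g‖ := by
    simpa only [_root_.one_mul] using sgn.norm_mul_le abs_sign_le_one g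
  exact (hle f).antisymm (by simpa only [sgn_mul_sgn_mul] using hle (sgn.mul f))

theorem norm_expAbs_mul_le (a : ℝ≥0) (f : L2 ℂ) : ‖(expAbs a).mul f‖ ≤ ‖f‖ := by
  simpa only [_root_.one_mul] using (expAbs a).norm_mul_le (C := 1)
    (fun x => by simpa only [expAbs, Real.abs_exp] using exp_neg_mul_abs_le_one a x) f

theorem real_inner_expAbs_add (a : ℝ≥0) (f g : L2 ℂ) :
    ⟪(expAbs (a + a)).mul f, g⟫_ℝ = ⟪(expAbs a).mul f, (expAbs a).mul g⟫_ℝ := by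
  rw [← expAbs_mul_expAbs, (expAbs a).real_inner_mul_left]

theorem real_inner_expAbs_two (f g : L2 ℂ) :
    ⟪(expAbs 2).mul f, g⟫_ℝ = ⟪(expAbs 1).mul f, (expAbs 1).mul g⟫_ℝ := by
  rw [← real_inner_expAbs_add, one_add_one_eq_two]

theorem real_inner_expAbs_four (f g : L2 ℂ) :
    ⟪(expAbs 4).mul f, g⟫_ℝ = ⟪(expAbs 2).mul f, (expAbs 2).mul g⟫_ℝ := by
  rw [← real_inner_expAbs_add, two_add_two_eq_four]

end Weight

/-! ### Weighted Leibniz rule -/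

namespace Weight

theorem mul_H1_mul (φ : Weight) (f : H1) (g : L2 ℂ) :
    φ.mul (H1.mul f g) = H1.mul f (φ.mul g) := by
  refine Lp.ext ?_
  filter_upwards [φ.coeFn_mul (H1.mul f g), H1.coeFn_mul f g, H1.coeFn_mul f (φ.mul g),
    φ.coeFn_mul g] with x hφfg hfg hfφg hφg
  rw [hφfg, hfg, hfφg, hφg]
  ring

theorem mul_conj (φ : Weight) (f : L2 ℂ) : φ.mul (L2.conj f) = L2.conj (φ.mul f) := by
  refine Lp.ext ?_
  filter_upwards [φ.coeFn_mul (L2.conj f), L2.coeFn_conj f, L2.coeFn_conj (φ.mul f),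
    φ.coeFn_mul f] with x hφconj hconj hconjφ hφ
  rw [hφconj, hconj, hconjφ, hφ, Complex.star_def, map_mul, Complex.conj_ofReal]

theorem mul_polar (φ : Weight) (f : H1) (g : L2 ℂ) :
    φ.mul (H1.polar f g) = H1.polar f (φ.mul g) := by
  rw [H1.polar, map_add, φ.mul_H1_mul, φ.mul_H1_mul, φ.mul_conj, H1.polar]

end Weight

theorem H1.polar_add (f : H1) (g h : L2 ℂ) :
    H1.polar f (g + h) = H1.polar f g + H1.polar f h := by
  simp only [H1.polar, map_add]
  abel

theorem H1.polar_toL2 (f : H1) : H1.polar f (H1.toL2 f) = (2 : ℝ) • H1.toL2 (H1.sq f) := by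
  have hcomm : H1.mul (H1.conj f) (H1.toL2 f) = H1.toL2 (H1.sq f) := by
    refine Lp.ext ?_
    filter_upwards [H1.coeFn_mul (H1.conj f) (H1.toL2 f), L2.coeFn_conj (H1.toL2 f),
      H1.coeFn_toL2_sq f] with x hmul hconj hsq
    replace hconj : H1.toL2 (H1.conj f) x = star (H1.toL2 f x) := hconj
    rw [hmul, hconj, hsq, Complex.star_def, Complex.conj_mul', Complex.ofReal_pow]
  rw [H1.polar, hcomm, ← H1.toL2_sq, two_smul]

/-! ### Functions vanishing at the origin -/

open Weight

/-- The continuous representative of `f` vanishes at the origin. -/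
def VanishesAtZero (f : H1) : Prop :=
  ∃ F, IsPrimitive F (H1.weakDeriv f) ∧ H1.toL2 f =ᵐ[volume] F ∧ F 0 = 0

/-- Multiplication by `exp (-|x|)` in `H¹`. -/
noncomputable def H1.expMul (f : H1) : H1 :=
  H1.mk _ _ ((hasDeriv_expAbs 1).isWeakDeriv (H1.isWeakDeriv f))

theorem H1.weakDeriv_expMul (f : H1) : H1.weakDeriv (H1.expMul f)
    = (expAbs 1).mul (H1.weakDeriv f) - sgn.mul ((expAbs 1).mul (H1.toL2 f)) := by
  change (expAbsDeriv 1).mul (H1.toL2 f) + (expAbs 1).mul (H1.weakDeriv f) = _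
  rw [expAbsDeriv_mul, NNReal.coe_one, one_smul]
  abel

namespace VanishesAtZero

variable {f : H1}

theorem expMul (h : VanishesAtZero f) : VanishesAtZero (H1.expMul f) := by
  obtain ⟨F, hF, hfF, h0⟩ := h
  refine ⟨fun x => (expAbs 1 x : ℂ) * F x, ?_, ?_, mul_eq_zero_of_right _ h0⟩
  · refine (IsPrimitive.mul (hasDeriv_expAbs 1) hF).congr ?_
    filter_upwards [Lp.coeFn_add ((expAbsDeriv 1).mul (H1.toL2 f))
        ((expAbs 1).mul (H1.weakDeriv f)), (expAbsDeriv 1).coeFn_mul (H1.toL2 f),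
      (expAbs 1).coeFn_mul (H1.weakDeriv f), hfF] with x hadd hleft hright hf
    change _ = ((expAbsDeriv 1).mul (H1.toL2 f) + (expAbs 1).mul (H1.weakDeriv f) : L2 ℂ) x
    rw [hadd, Pi.add_apply, hleft, hright, hf]
  · filter_upwards [(expAbs 1).coeFn_mul (H1.toL2 f), hfF] with x hmul hf
    exact hmul.trans (by rw [hf])

theorem sq (h : VanishesAtZero f) : VanishesAtZero (H1.sq f) := by
  obtain ⟨F, hF, hfF, h0⟩ := h
  refine ⟨fun x => star (F x) * F x, ?_, ?_, mul_eq_zero_of_right _ h0⟩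
  · refine (hF.star.mul hF).congr ?_
    filter_upwards [H1.coeFn_weakDeriv_sq f, hfF] with x hderiv hf
    rw [hderiv, hf, ← Complex.add_conj, map_mul, Complex.star_def, Complex.conj_conj]
    ring
  · filter_upwards [H1.coeFn_toL2_sq f, hfF] with x hsq hf
    rw [hsq, hf, Complex.star_def, Complex.conj_mul', Complex.ofReal_pow]

theorem isWeakDeriv_sgn_mul (h : VanishesAtZero f) :
    IsWeakDeriv (sgn.mul (H1.toL2 f)) (sgn.mul (H1.weakDeriv f)) := by
  obtain ⟨F, hF, hfF, h0⟩ := h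
  refine (hF.sign_mul h0).isWeakDeriv ?_ (sgn.coeFn_mul _)
  filter_upwards [sgn.coeFn_mul (H1.toL2 f), hfF] with x hsgn hf
  exact hsgn.trans (by rw [hf]; rfl)

-- Integrate `sgn · (|f|²)'` by parts against `exp (-2 |x|)`; since `f` vanishes at the origin, the
-- jump of `sgn` does not contribute.
theorem norm_sq_expAbs_mul (h : VanishesAtZero f) : ‖(expAbs 1).mul (H1.toL2 f)‖ ^ 2
    = ⟪sgn.mul ((expAbs 1).mul (H1.toL2 f)), (expAbs 1).mul (H1.weakDeriv f)⟫_ℝ := by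
  have hparts := h.isWeakDeriv_sgn_mul.real_inner_deriv_left
    ((hasDeriv_expAbs 2).isWeakDeriv (H1.isWeakDeriv f))
  have hleft : ⟪sgn.mul (H1.weakDeriv f), (expAbs 2).mul (H1.toL2 f)⟫_ℝ
      = ⟪sgn.mul ((expAbs 1).mul (H1.toL2 f)), (expAbs 1).mul (H1.weakDeriv f)⟫_ℝ := by
    rw [← (expAbs 2).real_inner_mul_left, real_inner_expAbs_two, real_inner_comm,
      Weight.mul_left_comm (expAbs 1) sgn, ← sgn.real_inner_mul_left]
  have hright : ⟪sgn.mul (H1.toL2 f), (expAbs 2).mul (H1.weakDeriv f)⟫_ℝ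
      = ⟪sgn.mul ((expAbs 1).mul (H1.toL2 f)), (expAbs 1).mul (H1.weakDeriv f)⟫_ℝ := by
    rw [← (expAbs 2).real_inner_mul_left, real_inner_expAbs_two,
      Weight.mul_left_comm (expAbs 1) sgn]
  have hweight : ⟪sgn.mul (H1.toL2 f), (expAbsDeriv 2).mul (H1.toL2 f)⟫_ℝ
      = -2 * ‖(expAbs 1).mul (H1.toL2 f)‖ ^ 2 := by
    rw [expAbsDeriv_mul, inner_neg_right, real_inner_smul_right, ← sgn.real_inner_mul_left,
      sgn_mul_sgn_mul, real_inner_comm, real_inner_expAbs_two, real_inner_self_eq_norm_sq,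
      NNReal.coe_ofNat]
    ring
  rw [inner_add_right, hleft, hright, hweight] at hparts
  linarith

theorem norm_expAbs_mul_le (h : VanishesAtZero f) :
    ‖(expAbs 1).mul (H1.toL2 f)‖ ≤ ‖(expAbs 1).mul (H1.weakDeriv f)‖ := by
  have hinner := real_inner_le_norm (sgn.mul ((expAbs 1).mul (H1.toL2 f)))
    ((expAbs 1).mul (H1.weakDeriv f))
  rw [← h.norm_sq_expAbs_mul, norm_sgn_mul, pow_two] at hinner
  by_contra! hlt
  exact absurd hinner (not_le.2 (mul_lt_mul_of_pos_left hlt ((norm_nonneg _).trans_lt hlt)))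

theorem norm_sq_weakDeriv_expMul (h : VanishesAtZero f) : ‖H1.weakDeriv (H1.expMul f)‖ ^ 2
    = ‖(expAbs 1).mul (H1.weakDeriv f)‖ ^ 2 - ‖(expAbs 1).mul (H1.toL2 f)‖ ^ 2 := by
  rw [H1.weakDeriv_expMul, norm_sub_sq_real, norm_sgn_mul, real_inner_comm,
    ← h.norm_sq_expAbs_mul]
  ring

theorem virial_quadratic_eq (h : VanishesAtZero f) :
    2 * ⟪(expAbs 2).mul (H1.weakDeriv f), H1.weakDeriv f⟫_ℝ
      + ⟪(expAbsDeriv 2).mul (H1.toL2 f), H1.weakDeriv f⟫_ℝ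
      = 2 * ‖H1.weakDeriv (H1.expMul f)‖ ^ 2 := by
  rw [h.norm_sq_weakDeriv_expMul, real_inner_expAbs_two, real_inner_self_eq_norm_sq,
    expAbsDeriv_mul, inner_neg_left, real_inner_smul_left, sgn.real_inner_mul_left,
    real_inner_expAbs_two, Weight.mul_left_comm (expAbs 1) sgn, ← sgn.real_inner_mul_left,
    ← h.norm_sq_expAbs_mul, NNReal.coe_ofNat]
  ring

theorem norm_expAbs_two_mul_le (h : VanishesAtZero f) :
    ‖(expAbs 2).mul (H1.toL2 f)‖ ≤ ‖H1.weakDeriv (H1.expMul f)‖ := by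
  rw [← one_add_one_eq_two (R := ℝ≥0), ← expAbs_mul_expAbs]
  exact h.expMul.norm_expAbs_mul_le.trans (Weight.norm_expAbs_mul_le 1 _)

theorem norm_expAbs_two_mul_weakDeriv_le (h : VanishesAtZero f) :
    ‖(expAbs 2).mul (H1.weakDeriv f)‖ ≤ 2 * ‖H1.weakDeriv (H1.expMul f)‖ := by
  have hsplit : (expAbs 2).mul (H1.weakDeriv f)
      = (expAbs 1).mul (H1.weakDeriv (H1.expMul f)) + sgn.mul ((expAbs 2).mul (H1.toL2 f)) := by
    rw [H1.weakDeriv_expMul, map_sub, Weight.mul_left_comm (expAbs 1) sgn, expAbs_mul_expAbs,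
      expAbs_mul_expAbs, one_add_one_eq_two, sub_add_cancel]
  rw [hsplit, two_mul]
  exact (norm_add_le _ _).trans (add_le_add (Weight.norm_expAbs_mul_le 1 _)
    ((norm_sgn_mul _).trans_le h.norm_expAbs_two_mul_le))

end VanishesAtZero

theorem H1.expAbs_mul_weakDeriv_sq (f : H1) : (expAbs 1).mul (H1.weakDeriv (H1.sq f))
    = H1.polar f (H1.weakDeriv (H1.expMul f))
      + (2 : ℝ) • sgn.mul ((expAbs 1).mul (H1.toL2 (H1.sq f))) := by
  have hsplit : (expAbs 1).mul (H1.weakDeriv f)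
      = H1.weakDeriv (H1.expMul f) + sgn.mul ((expAbs 1).mul (H1.toL2 f)) := by
    rw [H1.weakDeriv_expMul, sub_add_cancel]
  rw [H1.weakDeriv_sq, mul_polar, hsplit, H1.polar_add, ← mul_polar, ← mul_polar, H1.polar_toL2,
    (expAbs 1).mul.map_smul_of_tower, sgn.mul.map_smul_of_tower]

theorem VanishesAtZero.norm_expAbs_mul_sq_le {f : H1} (h : VanishesAtZero f) :
    ‖(expAbs 1).mul (H1.toL2 (H1.sq f))‖ ≤ 2 * ‖f‖ * ‖H1.weakDeriv (H1.expMul f)‖ := by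
  have hhardy := h.sq.norm_sq_expAbs_mul
  rw [H1.expAbs_mul_weakDeriv_sq, inner_add_right, real_inner_smul_right,
    real_inner_self_eq_norm_sq, norm_sgn_mul] at hhardy
  set b := (expAbs 1).mul (H1.toL2 (H1.sq f))
  have hinner : -⟪sgn.mul b, H1.polar f (H1.weakDeriv (H1.expMul f))⟫_ℝ
      ≤ ‖b‖ * (2 * ‖f‖ * ‖H1.weakDeriv (H1.expMul f)‖) := by
    refine (neg_le_abs _).trans ((abs_real_inner_le_norm _ _).trans ?_)
    rw [norm_sgn_mul]
    gcongr
    exact H1.norm_polar_le f _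
  by_contra! hlt
  have hb : 0 < ‖b‖ := lt_of_le_of_lt (by positivity) hlt
  nlinarith [mul_lt_mul_of_pos_left hlt hb]

/-! ### Weighted estimates -/

namespace Weight

theorem norm_mul_weakDeriv_sq_le (φ : Weight) (f : H1) :
    ‖φ.mul (H1.weakDeriv (H1.sq f))‖ ≤ 2 * ‖f‖ * ‖φ.mul (H1.weakDeriv f)‖ := by
  rw [H1.weakDeriv_sq, φ.mul_polar]
  exact H1.norm_polar_le f _

theorem real_inner_mul_H1_mul (φ : Weight) {N : L2 ℂ} (hN : L2.conj N = N) (f : H1) :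
    ⟪φ.mul (H1.toL2 f), H1.mul f N⟫_ℝ = ⟪φ.mul N, H1.toL2 (H1.sq f)⟫_ℝ := by
  have hφN : L2.conj (φ.mul N) = φ.mul N := by rw [← φ.mul_conj, hN]
  rw [real_inner_comm (H1.toL2 (H1.sq f)), H1.real_inner_sq_left hφN, ← φ.mul_H1_mul,
    φ.real_inner_mul_comm, real_inner_comm]

theorem abs_real_inner_expAbsDeriv_four_le (f g : L2 ℂ) :
    |⟪(expAbsDeriv 4).mul f, g⟫_ℝ| ≤ 4 * (‖(expAbs 2).mul f‖ * ‖(expAbs 2).mul g‖) := by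
  rw [expAbsDeriv_mul, inner_neg_left, real_inner_smul_left, sgn.real_inner_mul_left,
    real_inner_expAbs_four, Weight.mul_left_comm (expAbs 2) sgn, abs_neg, abs_mul, NNReal.abs_eq,
    NNReal.coe_ofNat, ← norm_sgn_mul ((expAbs 2).mul g)]
  gcongr
  exact abs_real_inner_le_norm _ _

theorem norm_expAbs_two_mul_le_norm_expAbs_one_mul (f : L2 ℂ) :
    ‖(expAbs 2).mul f‖ ≤ ‖(expAbs 1).mul f‖ := by
  rw [← one_add_one_eq_two (R := ℝ≥0), ← expAbs_mul_expAbs]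
  exact norm_expAbs_mul_le 1 _

end Weight

theorem H1.norm_weakDeriv_expMul_le (f : H1) :
    ‖H1.weakDeriv (H1.expMul f)‖ ≤ ‖H1.weakDeriv f‖ + ‖H1.toL2 f‖ := by
  rw [H1.weakDeriv_expMul]
  refine (norm_sub_le _ _).trans (add_le_add (norm_expAbs_mul_le 1 _) ?_)
  rw [norm_sgn_mul]
  exact norm_expAbs_mul_le 1 _

theorem H1.ae_norm_sq_expAbs_two_mul_le (f : H1) :
    ∀ᵐ x, ‖(expAbs 2).mul (H1.toL2 f) x‖ ^ 2 ≤ 6 * ‖f‖ * ‖(expAbs 2).mul (H1.toL2 f)‖ := by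
  have htoL2 : H1.toL2 (H1.expMul (H1.expMul f)) = (expAbs 2).mul (H1.toL2 f) := by
    rw [← one_add_one_eq_two (R := ℝ≥0), ← expAbs_mul_expAbs]
    rfl
  have hderiv : ‖H1.weakDeriv (H1.expMul (H1.expMul f))‖ ≤ 3 * ‖f‖ := by
    have hexp : ‖H1.toL2 (H1.expMul f)‖ ≤ ‖H1.toL2 f‖ := norm_expAbs_mul_le 1 _
    linarith [H1.norm_weakDeriv_expMul_le (H1.expMul f), H1.norm_weakDeriv_expMul_le f,
      H1.norm_toL2_le f, H1.norm_weakDeriv_le f]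
  obtain ⟨F, hF, hfF⟩ := (H1.isWeakDeriv (H1.expMul (H1.expMul f))).exists_isPrimitive
  rw [htoL2] at hfF
  filter_upwards [hfF] with x hx
  calc ‖(expAbs 2).mul (H1.toL2 f) x‖ ^ 2
      ≤ 2 * ‖(expAbs 2).mul (H1.toL2 f)‖ * ‖H1.weakDeriv (H1.expMul (H1.expMul f))‖ := by
        rw [hx]
        exact hF.norm_sq_le hfF x
    _ ≤ 2 * ‖(expAbs 2).mul (H1.toL2 f)‖ * (3 * ‖f‖) := by gcongr
    _ = 6 * ‖f‖ * ‖(expAbs 2).mul (H1.toL2 f)‖ := by ring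

namespace System

variable {u : ℝ → H1} {N V : ℝ → L2 ℂ} {t : ℝ}

/-! ### Boundedness of the wave component -/

theorem energy_eq (h : System u N V) {s : ℝ} (hs : 0 < s) (ht : 0 < t) :
    energy u N V s = energy u N V t :=
  isOpen_Ioi.is_const_of_deriv_eq_zero (s := Set.Ioi (0 : ℝ)) isPreconnected_Ioi
    (fun _ hr => (h.hasDerivAt_energy hr).differentiableAt.differentiableWithinAt)
    (fun _ hr => (h.hasDerivAt_energy hr).deriv) hs ht

theorem norm_sq_add_norm_sq_le_energy {K : ℝ} (hu : ‖u t‖ ≤ K) :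
    ‖N t‖ ^ 2 + ‖V t‖ ^ 2 ≤ 4 * energy u N V t + 4 * K ^ 4 := by
  have hK : 0 ≤ K := (norm_nonneg _).trans hu
  have hinteraction : |⟪H1.mul (u t) (N t), H1.toL2 (u t)⟫_ℝ| ≤ K * ‖N t‖ * K := by
    refine (abs_real_inner_le_norm _ _).trans ?_
    gcongr
    · exact (H1.norm_mul_le _ _).trans (by gcongr)
    · exact (H1.norm_toL2_le _).trans hu
  rw [energy]
  nlinarith [(abs_le.1 hinteraction).1, sq_nonneg ‖H1.weakDeriv (u t)‖,
    sq_nonneg (‖N t‖ - 2 * K ^ 2), sq_nonneg ‖V t‖]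

theorem exists_forall_norm_le (h : System u N V) {K : ℝ} (hu : ∀ t, 0 < t → ‖u t‖ ≤ K) :
    ∃ M, ∀ t, 0 < t → ‖N t‖ ≤ M ∧ ‖V t‖ ≤ M := by
  refine ⟨√(4 * energy u N V 1 + 4 * K ^ 4), fun t ht => ?_⟩
  have hle := norm_sq_add_norm_sq_le_energy (N := N) (V := V) (hu t ht)
  rw [h.energy_eq ht one_pos] at hle
  exact ⟨Real.le_sqrt_of_sq_le (by linarith [sq_nonneg ‖V t‖]),
    Real.le_sqrt_of_sq_le (by linarith [sq_nonneg ‖N t‖])⟩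

/-! ### The virial identity -/

/-- The virial functional `∫ ψ (Im (ū u_x) + n v)` for the bounded odd weight
`ψ = ∫₀ˣ exp (-2 |y|) dy`. -/
noncomputable def virial (u : ℝ → H1) (N V : ℝ → L2 ℂ) (t : ℝ) : ℝ :=
  ⟪Complex.I • H1.toL2 (u t), expAbsPrimitive.mul (H1.weakDeriv (u t))⟫_ℝ
    + ⟪expAbsPrimitive.mul (N t), V t⟫_ℝ

/-- The time derivative of the virial functional along solutions vanishing at the origin. -/
noncomputable def virialRate (u : ℝ → H1) (N V : ℝ → L2 ℂ) (t : ℝ) : ℝ :=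
  2 * ‖H1.weakDeriv (H1.expMul (u t))‖ ^ 2
    + ⟪(expAbs 1).mul (N t), (expAbs 1).mul (H1.toL2 (H1.sq (u t)))⟫_ℝ
    + (‖(expAbs 1).mul (N t)‖ ^ 2 + ‖(expAbs 1).mul (V t)‖ ^ 2) / 2

/-- The positive definite part of the virial rate that survives the absorption of the cubic term;
its integrability in time drives the decay. -/
noncomputable def dissipation (u : ℝ → H1) (N V : ℝ → L2 ℂ) (t : ℝ) : ℝ :=
  ‖H1.weakDeriv (H1.expMul (u t))‖ ^ 2
    + (‖(expAbs 1).mul (N t)‖ ^ 2 + ‖(expAbs 1).mul (V t)‖ ^ 2) / 4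

theorem dissipation_nonneg (u : ℝ → H1) (N V : ℝ → L2 ℂ) (t : ℝ) : 0 ≤ dissipation u N V t := by
  unfold dissipation
  positivity

theorem hasDerivAt_virial (h : System u N V) (h0 : VanishesAtZero (u t)) (ht : 0 < t) :
    HasDerivAt (virial u N V) (virialRate u N V t) t := by
  have hN := h.schrodinger.conj_potential t
  refine ((h.schrodinger.hasDerivAt_momentum hasDeriv_expAbsPrimitive (hasDeriv_expAbs 2) ht).add
    (h.hasDerivAt_waveMomentum hasDeriv_expAbsPrimitive ht)).congr_deriv ?_
  rw [h0.virial_quadratic_eq, expAbsPrimitive.real_inner_weakDeriv_sq hN,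
    (expAbs 2).real_inner_mul_H1_mul hN, real_inner_expAbs_two, real_inner_expAbs_two,
    real_inner_expAbs_two, real_inner_self_eq_norm_sq, real_inner_self_eq_norm_sq, virialRate]
  ring

theorem dissipation_le_virialRate (h0 : VanishesAtZero (u t)) (hu : ‖u t‖ ≤ 1 / 2) :
    dissipation u N V t ≤ virialRate u N V t := by
  have hsq : ‖(expAbs 1).mul (H1.toL2 (H1.sq (u t)))‖ ≤ ‖H1.weakDeriv (H1.expMul (u t))‖ :=
    h0.norm_expAbs_mul_sq_le.trans (mul_le_of_le_one_left (norm_nonneg _) (by linarith))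
  have hcubic : |⟪(expAbs 1).mul (N t), (expAbs 1).mul (H1.toL2 (H1.sq (u t)))⟫_ℝ|
      ≤ ‖(expAbs 1).mul (N t)‖ * ‖H1.weakDeriv (H1.expMul (u t))‖ :=
    (abs_real_inner_le_norm _ _).trans (by gcongr)
  rw [dissipation, virialRate]
  nlinarith [(abs_le.1 hcubic).1, sq_nonneg ‖(expAbs 1).mul (V t)‖,
    sq_nonneg (‖H1.weakDeriv (H1.expMul (u t))‖ - ‖(expAbs 1).mul (N t)‖ / 2)]

theorem continuousOn_dissipation (h : System u N V) :
    ContinuousOn (dissipation u N V) (Set.Ioi 0) := by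
  have hu : ContinuousOn (fun t => H1.weakDeriv (H1.expMul (u t))) (Set.Ioi 0) := by
    simp only [H1.weakDeriv_expMul]
    exact ((expAbs 1).mul.continuous.comp_continuousOn h.schrodinger.continuousOn_weakDeriv).sub
      (sgn.mul.continuous.comp_continuousOn
        ((expAbs 1).mul.continuous.comp_continuousOn h.schrodinger.continuousOn_toL2))
  have hN := (expAbs 1).mul.continuous.comp_continuousOn h.density.continuousOn
  have hV := (expAbs 1).mul.continuous.comp_continuousOn h.velocity.continuousOn
  exact (hu.norm.pow 2).add (((hN.norm.pow 2).add (hV.norm.pow 2)).div_const 4)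

theorem abs_virial_le {K M : ℝ} (hu : ‖u t‖ ≤ K) (hN : ‖N t‖ ≤ M) (hV : ‖V t‖ ≤ M) :
    |virial u N V t| ≤ K * (‖expAbsPrimitive.mul‖ * K) + ‖expAbsPrimitive.mul‖ * M * M := by
  refine (abs_add_le _ _).trans (add_le_add ?_ ?_)
  · have hI : ‖Complex.I • H1.toL2 (u t)‖ ≤ K := by
      rw [norm_smul, Complex.norm_I, one_mul]
      exact (H1.norm_toL2_le _).trans hu
    exact (abs_real_inner_le_norm _ _).trans (mul_le_mul hI
      (expAbsPrimitive.mul.le_opNorm_of_le ((H1.norm_weakDeriv_le _).trans hu)) (norm_nonneg _)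
      ((norm_nonneg _).trans hu))
  · exact (abs_real_inner_le_norm _ _).trans (mul_le_mul (expAbsPrimitive.mul.le_opNorm_of_le hN)
      hV (norm_nonneg _) (mul_nonneg (norm_nonneg _) ((norm_nonneg _).trans hN)))

theorem integral_dissipation_le (h : System u N V) (hu : ∀ t, 0 < t → ‖u t‖ ≤ 1 / 2)
    (h0 : ∀ t, 0 < t → VanishesAtZero (u t)) {T : ℝ} (hT : 1 ≤ T) :
    ∫ t in (1 : ℝ)..T, dissipation u N V t ≤ virial u N V T - virial u N V 1 := by
  have hpos : ∀ t ∈ Set.Icc 1 T, 0 < t := fun t ht => one_pos.trans_le ht.1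
  have hderiv (t : ℝ) (ht : t ∈ Set.Icc 1 T) :
      HasDerivAt (virial u N V) (virialRate u N V t) t :=
    h.hasDerivAt_virial (h0 t (hpos t ht)) (hpos t ht)
  exact intervalIntegral.integral_le_sub_of_hasDeriv_right_of_le hT
    (fun t ht => (hderiv t ht).continuousAt.continuousWithinAt)
    (fun t ht => (hderiv t (Set.Ioo_subset_Icc_self ht)).hasDerivWithinAt)
    (h.continuousOn_dissipation.mono hpos).integrableOn_Icc
    fun t ht => dissipation_le_virialRate (h0 t (hpos t (Set.Ioo_subset_Icc_self ht)))
      (hu t (hpos t (Set.Ioo_subset_Icc_self ht)))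

theorem integrableOn_dissipation (h : System u N V) (hu : ∀ t, 0 < t → ‖u t‖ ≤ 1 / 2)
    (h0 : ∀ t, 0 < t → VanishesAtZero (u t)) :
    IntegrableOn (dissipation u N V) (Set.Ioi 1) := by
  obtain ⟨M, hM⟩ := h.exists_forall_norm_le hu
  obtain ⟨B, hB⟩ : ∃ B, ∀ t, 0 < t → |virial u N V t| ≤ B :=
    ⟨_, fun t ht => abs_virial_le (hu t ht) (hM t ht).1 (hM t ht).2⟩
  refine integrableOn_Ioi_of_intervalIntegral_norm_bounded (2 * B) 1 (fun T => ?_) tendsto_id ?_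
  · have hpos : Set.Icc 1 T ⊆ Set.Ioi 0 := fun t ht => one_pos.trans_le ht.1
    exact (h.continuousOn_dissipation.mono hpos).integrableOn_Icc.mono_set
      Set.Ioc_subset_Icc_self
  · filter_upwards [eventually_ge_atTop 1] with T hT
    simp only [Real.norm_of_nonneg (dissipation_nonneg u N V _), id]
    linarith [h.integral_dissipation_le hu h0 hT, (abs_le.1 (hB 1 one_pos)).1,
      (abs_le.1 (hB T (one_pos.trans_le hT))).2]

/-! ### Decay of the localized mass -/

/-- The mass and wave energy localized by `exp (-4 |x|)`. -/
noncomputable def localMass (u : ℝ → H1) (N V : ℝ → L2 ℂ) (t : ℝ) : ℝ :=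
  ‖(expAbs 2).mul (H1.toL2 (u t))‖ ^ 2
    + (‖(expAbs 2).mul (N t)‖ ^ 2 + ‖(expAbs 2).mul (V t)‖ ^ 2)

/-- The time derivative of the localized mass. -/
noncomputable def localMassRate (u : ℝ → H1) (N V : ℝ → L2 ℂ) (t : ℝ) : ℝ :=
  -2 * ⟪(expAbsDeriv 4).mul (H1.toL2 (u t)), Complex.I • H1.weakDeriv (u t)⟫_ℝ
    + (2 * ⟪(expAbsDeriv 4).mul (N t), V t⟫_ℝ
      - 2 * ⟪(expAbs 4).mul (V t), H1.weakDeriv (H1.sq (u t))⟫_ℝ)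

theorem localMass_nonneg (u : ℝ → H1) (N V : ℝ → L2 ℂ) (t : ℝ) : 0 ≤ localMass u N V t := by
  unfold localMass
  positivity

theorem localMass_le (h0 : VanishesAtZero (u t)) :
    localMass u N V t ≤ 4 * dissipation u N V t := by
  have hu := pow_le_pow_left₀ (norm_nonneg _) h0.norm_expAbs_two_mul_le 2
  have hN := pow_le_pow_left₀ (norm_nonneg _) (norm_expAbs_two_mul_le_norm_expAbs_one_mul (N t)) 2
  have hV := pow_le_pow_left₀ (norm_nonneg _) (norm_expAbs_two_mul_le_norm_expAbs_one_mul (V t)) 2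
  rw [localMass, dissipation]
  linarith [sq_nonneg ‖H1.weakDeriv (H1.expMul (u t))‖]

theorem hasDerivAt_localMass (h : System u N V) (ht : 0 < t) :
    HasDerivAt (localMass u N V) (localMassRate u N V t) t := by
  have hderiv := (h.schrodinger.hasDerivAt_weight (hasDeriv_expAbs 4) ht).add
    (h.hasDerivAt_waveEnergy (hasDeriv_expAbs 4) ht)
  simp only [real_inner_expAbs_four (H1.toL2 _), real_inner_expAbs_four (N _) (N _),
    real_inner_expAbs_four (V _) (V _), real_inner_self_eq_norm_sq] at hderiv
  exact hderiv

theorem abs_localMassRate_le (h0 : VanishesAtZero (u t)) (hu : ‖u t‖ ≤ 1 / 2) :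
    |localMassRate u N V t| ≤ 24 * dissipation u N V t := by
  have hn := norm_expAbs_two_mul_le_norm_expAbs_one_mul (N t)
  have hv := norm_expAbs_two_mul_le_norm_expAbs_one_mul (V t)
  rw [localMassRate, dissipation]
  set w := ‖H1.weakDeriv (H1.expMul (u t))‖
  set n := ‖(expAbs 1).mul (N t)‖
  set v := ‖(expAbs 1).mul (V t)‖
  have hmass : |⟪(expAbsDeriv 4).mul (H1.toL2 (u t)), Complex.I • H1.weakDeriv (u t)⟫_ℝ|
      ≤ 4 * (w * (2 * w)) := by
    refine (abs_real_inner_expAbsDeriv_four_le _ _).trans ?_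
    rw [map_smul, norm_smul, Complex.norm_I, one_mul]
    gcongr
    exacts [h0.norm_expAbs_two_mul_le, h0.norm_expAbs_two_mul_weakDeriv_le]
  have hwave : |⟪(expAbsDeriv 4).mul (N t), V t⟫_ℝ| ≤ 4 * (n * v) :=
    (abs_real_inner_expAbsDeriv_four_le _ _).trans (by gcongr)
  have hsq : ‖(expAbs 2).mul (H1.weakDeriv (H1.sq (u t)))‖ ≤ 2 * w :=
    calc ‖(expAbs 2).mul (H1.weakDeriv (H1.sq (u t)))‖
        ≤ 2 * ‖u t‖ * ‖(expAbs 2).mul (H1.weakDeriv (u t))‖ :=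
          (expAbs 2).norm_mul_weakDeriv_sq_le _
      _ ≤ 2 * (1 / 2) * (2 * w) := by gcongr; exact h0.norm_expAbs_two_mul_weakDeriv_le
      _ = 2 * w := by ring
  have hforcing : |⟪(expAbs 4).mul (V t), H1.weakDeriv (H1.sq (u t))⟫_ℝ| ≤ v * (2 * w) := by
    rw [real_inner_expAbs_four]
    exact (abs_real_inner_le_norm _ _).trans (by gcongr)
  rw [abs_le] at hmass hwave hforcing ⊢
  constructor <;>
    nlinarith [sq_nonneg (n - v), sq_nonneg (w - v), sq_nonneg n, sq_nonneg w]

theorem tendsto_localMass (h : System u N V) (hu : ∀ t, 0 < t → ‖u t‖ ≤ 1 / 2)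
    (h0 : ∀ t, 0 < t → VanishesAtZero (u t)) :
    Tendsto (localMass u N V) atTop (𝓝 0) := by
  have hint := h.integrableOn_dissipation hu h0
  have hderiv (t : ℝ) (ht : 1 < t) := h.hasDerivAt_localMass (one_pos.trans ht)
  have hcont : ContinuousOn (localMass u N V) (Set.Ioi 1) :=
    fun t ht => (hderiv t ht).continuousAt.continuousWithinAt
  refine tendsto_zero_of_hasDerivAt_of_integrableOn_Ioi (a := 1)
    (f' := deriv (localMass u N V))
    (fun t ht => (hderiv t ht).differentiableAt.hasDerivAt) ?_ ?_
  · refine (hint.const_mul 24).mono' (measurable_deriv _).aestronglyMeasurable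
      (ae_restrict_of_forall_mem measurableSet_Ioi fun t ht => ?_)
    rw [(hderiv t ht).deriv]
    exact abs_localMassRate_le (h0 t (one_pos.trans ht)) (hu t (one_pos.trans ht))
  · refine (hint.const_mul 4).mono' (hcont.aestronglyMeasurable measurableSet_Ioi)
      (ae_restrict_of_forall_mem measurableSet_Ioi fun t ht => ?_)
    rw [Real.norm_of_nonneg (localMass_nonneg u N V t)]
    exact localMass_le (h0 t (one_pos.trans ht))

end System

/-! ### Complexification -/

/-- The inclusion of the real `L²` in the complex `L²`; it carries the real wave fields to the
setting in which the system is analysed. -/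
noncomputable def L2.ofReal : L2 ℝ →L[ℝ] L2 ℂ := Complex.ofRealCLM.compLpL 2 volume

theorem L2.coeFn_ofReal (f : L2 ℝ) : L2.ofReal f =ᵐ[volume] fun x => (f x : ℂ) :=
  Complex.ofRealCLM.coeFn_compLpL f

theorem L2.conj_ofReal (f : L2 ℝ) : L2.conj (L2.ofReal f) = L2.ofReal f := by
  refine Lp.ext ?_
  filter_upwards [L2.coeFn_conj (L2.ofReal f), L2.coeFn_ofReal f] with x hconj hreal
  rw [hconj, hreal, Complex.star_def, Complex.conj_ofReal]

theorem IsTest.inner_ofReal {η : ℝ → ℝ} (h : IsTest η) (f : L2 ℝ) :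
    ⟪h.toL2, L2.ofReal f⟫_ℂ = ((∫ x, η x * f x : ℝ) : ℂ) := by
  rw [h.inner_toL2, ← integral_complex_ofReal]
  refine integral_congr_ae ?_
  filter_upwards [L2.coeFn_ofReal f] with x hx
  rw [hx, Complex.ofReal_mul]

theorem IsTest.inner_mul_ofReal {η : ℝ → ℝ} (h : IsTest η) (f : H1) (g : L2 ℝ) :
    ⟪h.toL2, H1.mul f (L2.ofReal g)⟫_ℂ = ∫ x, (η x : ℂ) * ((g x : ℂ) * H1.toL2 f x) := by
  rw [h.inner_toL2]
  refine integral_congr_ae ?_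
  filter_upwards [H1.coeFn_mul f (L2.ofReal g), L2.coeFn_ofReal g] with x hmul hreal
  rw [hmul, hreal, mul_comm (H1.toL2 f x)]

theorem IsTest.inner_ofReal_add_sq {η : ℝ → ℝ} (h : IsTest η) (g : L2 ℝ) (f : H1) :
    ⟪h.toL2, L2.ofReal g + H1.toL2 (H1.sq f)⟫_ℂ
      = ((∫ x, η x * (g x + ‖H1.toL2 f x‖ ^ 2) : ℝ) : ℂ) := by
  rw [h.inner_toL2, ← integral_complex_ofReal]
  refine integral_congr_ae ?_
  filter_upwards [Lp.coeFn_add (L2.ofReal g) (H1.toL2 (H1.sq f)), L2.coeFn_ofReal g,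
    H1.coeFn_toL2_sq f] with x hadd hreal hsq
  rw [hadd, Pi.add_apply, hreal, hsq]
  push_cast
  rfl

namespace IsSolution

variable {u : ℝ → H1} {n v : ℝ → L2 ℝ}

theorem schrodingerEq (h : IsSolution u n v) (hu : ContinuousOn u (Set.Ioi 0))
    (hn : ContinuousOn n (Set.Ioi 0)) : SchrodingerEq u (fun t => L2.ofReal (n t)) := by
  have hN : ContinuousOn (fun t => L2.ofReal (n t)) (Set.Ioi 0) :=
    L2.ofReal.continuous.comp_continuousOn hn
  refine ⟨hu, hN, fun t => L2.conj_ofReal _, IsWeakEvolution.of_test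
    (H1.toL2CLM.continuous.comp_continuousOn hu)
    ((H1.weakDerivCLM.continuous.comp_continuousOn hu).const_smul (-Complex.I))
    (((H1.mul.continuous.comp_continuousOn hu).clm_apply hN).const_smul (-Complex.I))
    fun η hη t ht => ?_⟩
  simp only [hη.inner_toL2 (H1.toL2 _)]
  refine (h.schrodinger η hη t ht).congr_deriv ?_
  rw [← hη.inner_mul_ofReal, ← hη.deriv.deriv.inner_toL2,
    isWeakDeriv_iff.1 (H1.isWeakDeriv (u t)) _ hη.deriv, inner_smul_right, inner_smul_right]
  ring

theorem system (h : IsSolution u n v) (hu : ContinuousOn u (Set.Ioi 0))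
    (hn : ContinuousOn n (Set.Ioi 0)) (hv : ContinuousOn v (Set.Ioi 0)) :
    System u (fun t => L2.ofReal (n t)) (fun t => L2.ofReal (v t)) := by
  have hN : ContinuousOn (fun t => L2.ofReal (n t)) (Set.Ioi 0) :=
    L2.ofReal.continuous.comp_continuousOn hn
  have hV : ContinuousOn (fun t => L2.ofReal (v t)) (Set.Ioi 0) :=
    L2.ofReal.continuous.comp_continuousOn hv
  refine ⟨h.schrodingerEq hu hn,
    IsWeakEvolution.of_test hN hV continuousOn_const fun η hη t ht => ?_,
    IsWeakEvolution.of_test hV hN (H1.continuous_weakDeriv_sq.comp_continuousOn hu).neg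
      fun η hη t ht => ?_⟩
  · simp only [hη.inner_ofReal, hη.deriv.inner_ofReal, inner_zero_right, add_zero]
    exact (h.density η hη t ht).ofReal_comp
  · rw [inner_neg_right, ← isWeakDeriv_iff.1 (H1.isWeakDeriv (H1.sq (u t))) _ hη,
      ← inner_add_right, hη.deriv.inner_ofReal_add_sq]
    simp only [hη.inner_ofReal]
    exact (h.velocity η hη t ht).ofReal_comp

end IsSolution

theorem IsOdd.vanishesAtZero {f : H1} (h : IsOdd (H1.toL2 f)) : VanishesAtZero f := by
  obtain ⟨F, hF, hfF⟩ := (H1.isWeakDeriv f).exists_isPrimitive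
  have hae : (fun x => F (-x)) =ᵐ[volume] fun x => -F x := by
    filter_upwards [h, hfF, (Measure.measurePreserving_neg (volume : Measure ℝ)
      ).quasiMeasurePreserving.ae hfF] with x hodd hx hneg
    rw [← hneg, hodd, hx]
  have hodd : (fun x => F (-x)) = fun x => -F x :=
    (Continuous.ae_eq_iff_eq volume (hF.continuous.comp continuous_neg) hF.continuous.neg).1 hae
  exact ⟨F, hF, hfF, self_eq_neg.1 (by simpa only [neg_zero] using congrFun hodd 0)⟩

/-! ### Local norms -/

theorem norm_le_exp_mul_norm_expAbs_mul {a b x : ℝ} (hx : x ∈ Set.Icc a b) (z : ℂ) :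
    ‖z‖ ≤ Real.exp (2 * max |a| |b|) * ‖(expAbs 2 x : ℂ) * z‖ := by
  have hle : |x| ≤ max |a| |b| := abs_le_max_abs_abs hx.1 hx.2
  rw [norm_mul, Complex.norm_real, expAbs, Real.norm_of_nonneg (Real.exp_pos _).le, ← mul_assoc,
    ← Real.exp_add, NNReal.coe_ofNat]
  exact le_mul_of_one_le_left (norm_nonneg _) (Real.one_le_exp (by linarith))

theorem eLpNorm_restrict_Icc_le (f : L2 ℂ) (a b : ℝ) :
    eLpNorm f 2 (volume.restrict (Set.Icc a b))
      ≤ ENNReal.ofReal (Real.exp (2 * max |a| |b|) * ‖(expAbs 2).mul f‖) := by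
  rw [ENNReal.ofReal_mul (Real.exp_pos _).le, ofReal_norm, Lp.enorm_def]
  refine (eLpNorm_le_mul_eLpNorm_of_ae_le_mul (g := (expAbs 2).mul f) ?_ 2).trans
    (mul_le_mul_right (eLpNorm_mono_measure _ Measure.restrict_le_self) _)
  filter_upwards [ae_restrict_of_ae ((expAbs 2).coeFn_mul f), ae_restrict_mem measurableSet_Icc]
    with x hmul hx
  rw [hmul]
  exact norm_le_exp_mul_norm_expAbs_mul hx _

theorem eLpNorm_top_restrict_Icc_le (f : H1) (a b : ℝ) :
    eLpNorm (H1.toL2 f) ∞ (volume.restrict (Set.Icc a b))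
      ≤ ENNReal.ofReal (Real.exp (2 * max |a| |b|)
        * √(6 * ‖f‖ * ‖(expAbs 2).mul (H1.toL2 f)‖)) := by
  rw [eLpNorm_exponent_top]
  refine eLpNormEssSup_le_of_ae_bound ?_
  filter_upwards [ae_restrict_of_ae ((expAbs 2).coeFn_mul (H1.toL2 f)),
    ae_restrict_of_ae (H1.ae_norm_sq_expAbs_two_mul_le f), ae_restrict_mem measurableSet_Icc]
    with x hmul hsq hx
  refine (norm_le_exp_mul_norm_expAbs_mul hx _).trans ?_
  rw [← hmul]
  gcongr
  exact Real.le_sqrt_of_sq_le hsq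

theorem eLpNorm_ofReal (f : L2 ℝ) (a b : ℝ) :
    eLpNorm (L2.ofReal f) 2 (volume.restrict (Set.Icc a b))
      = eLpNorm f 2 (volume.restrict (Set.Icc a b)) := by
  refine eLpNorm_congr_norm_ae (ae_restrict_of_ae ?_)
  filter_upwards [L2.coeFn_ofReal f] with x hx
  rw [hx, Complex.norm_real]

section Limits

variable {α : Type*} {l : Filter α}

theorem tendsto_zero_of_norm_sq_le {E : Type*} [SeminormedAddGroup E] {f : α → E} {m : α → ℝ}
    (hm : Tendsto m l (𝓝 0)) (hle : ∀ t, ‖f t‖ ^ 2 ≤ m t) : Tendsto f l (𝓝 0) := by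
  refine squeeze_zero_norm (fun t => Real.le_sqrt_of_sq_le (hle t)) ?_
  simpa only [Real.sqrt_zero] using hm.sqrt

theorem tendsto_eLpNorm_restrict_Icc {f : α → L2 ℂ}
    (hf : Tendsto (fun t => (expAbs 2).mul (f t)) l (𝓝 0)) (a b : ℝ) :
    Tendsto (fun t => eLpNorm (f t) 2 (volume.restrict (Set.Icc a b))) l (𝓝 0) := by
  refine tendsto_of_tendsto_of_tendsto_of_le_of_le tendsto_const_nhds ?_
    (fun _ => zero_le) (fun t => eLpNorm_restrict_Icc_le (f t) a b)
  simpa only [norm_zero, mul_zero, ENNReal.ofReal_zero]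
    using ENNReal.tendsto_ofReal (hf.norm.const_mul (Real.exp (2 * max |a| |b|)))

theorem tendsto_eLpNorm_top_restrict_Icc {f : α → H1} {K : ℝ} (hK : ∀ᶠ t in l, ‖f t‖ ≤ K)
    (hf : Tendsto (fun t => (expAbs 2).mul (H1.toL2 (f t))) l (𝓝 0)) (a b : ℝ) :
    Tendsto (fun t => eLpNorm (H1.toL2 (f t)) ∞ (volume.restrict (Set.Icc a b))) l (𝓝 0) := by
  have hlim : Tendsto (fun t => ENNReal.ofReal (Real.exp (2 * max |a| |b|)
      * √(6 * K * ‖(expAbs 2).mul (H1.toL2 (f t))‖))) l (𝓝 0) := by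
    simpa only [norm_zero, mul_zero, Real.sqrt_zero, ENNReal.ofReal_zero]
      using ENNReal.tendsto_ofReal ((hf.norm.const_mul (6 * K)).sqrt.const_mul _)
  refine tendsto_of_tendsto_of_tendsto_of_le_of_le' tendsto_const_nhds hlim
    (Eventually.of_forall fun _ => zero_le) ?_
  filter_upwards [hK] with t ht
  exact (eLpNorm_top_restrict_Icc_le (f t) a b).trans (by gcongr)

end Limits

namespace System

variable {u : ℝ → H1} {N V : ℝ → L2 ℂ}

theorem tendsto_expAbs_two_mul (h : System u N V) (hu : ∀ t, 0 < t → ‖u t‖ ≤ 1 / 2)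
    (h0 : ∀ t, 0 < t → VanishesAtZero (u t)) :
    Tendsto (fun t => (expAbs 2).mul (H1.toL2 (u t))) atTop (𝓝 0) ∧
      Tendsto (fun t => (expAbs 2).mul (N t)) atTop (𝓝 0) ∧
      Tendsto (fun t => (expAbs 2).mul (V t)) atTop (𝓝 0) := by
  have hmass := h.tendsto_localMass hu h0
  refine ⟨tendsto_zero_of_norm_sq_le hmass fun t => ?_,
    tendsto_zero_of_norm_sq_le hmass fun t => ?_, tendsto_zero_of_norm_sq_le hmass fun t => ?_⟩ <;>
  · rw [localMass]
    linarith [sq_nonneg ‖(expAbs 2).mul (H1.toL2 (u t))‖, sq_nonneg ‖(expAbs 2).mul (N t)‖,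
      sq_nonneg ‖(expAbs 2).mul (V t)‖]

end System

theorem norm_le_of_iSup_enorm_lt {E : Type*} [SeminormedAddGroup E] {u : ℝ → E} {ε : ℝ}
    (hε : 0 ≤ ε) (h : (⨆ t : Set.Ici (0 : ℝ), ‖u t‖ₑ) < ENNReal.ofReal ε) {t : ℝ} (ht : 0 ≤ t) :
    ‖u t‖ ≤ ε := by
  have hle : ‖u t‖ₑ ≤ ENNReal.ofReal ε :=
    (le_iSup (fun s : Set.Ici (0 : ℝ) => ‖u s‖ₑ) ⟨t, ht⟩).trans h.le
  rwa [← ofReal_norm, ENNReal.ofReal_le_ofReal_iff hε] at hle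

end Zakharov

theorem theorem1_general (u : ℝ → Zakharov.H1) (n v : ℝ → Zakharov.L2 ℝ)
    (hcont : ContinuousOn (fun t => (u t, n t, v t)) (Set.Ioi 0))
    (hsol : Zakharov.IsSolution u n v) (hzero : ∀ t, 0 < t → Zakharov.VanishesAtZero (u t))
    (hsmall : ∀ t, 0 < t → ‖u t‖ ≤ 1 / 2) (a b : ℝ) :
    Tendsto (fun t : ℝ =>
      eLpNorm (Zakharov.H1.toL2 (u t)) ∞ (volume.restrict (Set.Icc a b))
        + eLpNorm (Zakharov.H1.toL2 (u t)) 2 (volume.restrict (Set.Icc a b))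
        + eLpNorm (n t) 2 (volume.restrict (Set.Icc a b))
        + eLpNorm (v t) 2 (volume.restrict (Set.Icc a b)))
      atTop (𝓝 0) := by
  have hsys := hsol.system hcont.fst hcont.snd.fst hcont.snd.snd
  obtain ⟨hu, hn, hv⟩ := hsys.tendsto_expAbs_two_mul hsmall hzero
  have hbound : ∀ᶠ t in atTop, ‖u t‖ ≤ 1 / 2 := (eventually_gt_atTop 0).mono hsmall
  simpa only [Zakharov.eLpNorm_ofReal, add_zero] using
    (((Zakharov.tendsto_eLpNorm_top_restrict_Icc hbound hu a b).add
      (Zakharov.tendsto_eLpNorm_restrict_Icc hu a b)).add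
      (Zakharov.tendsto_eLpNorm_restrict_Icc hn a b)).add
      (Zakharov.tendsto_eLpNorm_restrict_Icc hv a b)

theorem theorem1 :
    ∃ ε : ℝ, 0 < ε ∧
      ∀ (u : ℝ → Zakharov.H1) (n v : ℝ → Zakharov.L2 ℝ),
        ContinuousOn (fun t => (u t, n t, v t)) (Set.Ici 0) →
        Zakharov.IsSolution u n v →
        (∀ t : ℝ, 0 ≤ t → Zakharov.IsOdd (Zakharov.H1.toL2 (u t))) →
        (⨆ t : Set.Ici (0 : ℝ), ‖u t‖ₑ) < ENNReal.ofReal ε →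
        ∀ a b : ℝ,
          Tendsto (fun t : ℝ =>
            eLpNorm (Zakharov.H1.toL2 (u t)) ∞ (volume.restrict (Set.Icc a b))
              + eLpNorm (Zakharov.H1.toL2 (u t)) 2 (volume.restrict (Set.Icc a b))
              + eLpNorm (n t) 2 (volume.restrict (Set.Icc a b))
              + eLpNorm (v t) 2 (volume.restrict (Set.Icc a b)))
            atTop (𝓝 0) := by
  refine ⟨1 / 2, by norm_num, fun u n v hcont hsol hodd hsmall => ?_⟩
  exact theorem1_general u n v (hcont.mono Set.Ioi_subset_Ici_self) hsol
    (fun t ht => (hodd t ht.le).vanishesAtZero)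
    fun t ht => Zakharov.norm_le_of_iSup_enorm_lt (by norm_num) hsmall ht.le
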